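/- Let $d\ge 1$ and $\widehat f(\xi)=\int_{\mathbb R^d} f(x)e^{-2\pi i\langle x,\xi\rangle}\,dx$ for $f\in L^1(\mathbb R^d)$, extended to $L^1+L^2$ by Plancherel. For $1\le p,q\le\infty$ and $\alpha,\beta,x>0$ put $$H(x)=\sup\big\{\|f\|_q : f\in L^1(\mathbb R^d)+L^2(\mathbb R^d),\ \|f\,|\cdot|^\alpha\|_q\le x,\ \|\widehat f\,|\cdot|^\beta\|_p\le 1\big\}\in[0,\infty].$$ A bounded linear operator $T$ on $L^2(\mathbb R^d)$ is called a special Hadamard operator if $\|Tf\|_\infty\le\|f\|_1$ for all $f\in L^1\cap L^2$, $\|Tf\|_2\le\|f\|_2$ for all $f\in L^2$, and $T^*=T^{-1}$. Theorem. For every $d\ge 1$ and every $1\le p\le\infty$ there are real numbers $\beta_0,q_0$ and $\alpha_0>0$ such that for all $\beta>0$ with $\beta>\beta_0$, all $1\le q\le\infty$ with $q>q_0$, all $0<\alpha<\alpha_0$ and all $x>0$, $$H(x)<\infty,$$ but $$\sup_T\ \sup\big\{\|Tf\|_q : f\in L^1\cap L^2,\ \|Tf\,|\cdot|^\alpha\|_q\le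 x,\ \|f\,|\cdot|^\beta\|_p\le 1\big\}=\infty$$ and also $$\sup_T\ \sup\big\{\|f\|_q : f\in L^1\cap L^2,\ \|f\,|\cdot|^\alpha\|_q\le x,\ \|Tf\,|\cdot|^\beta\|_p\le 1\big\}=\infty,$$ where $T$ ranges over all special Hadamard operators on $L^2(\mathbb R^d)$. -/

import Mathlib

open MeasureTheory FourierTransform
open scoped ENNReal

noncomputable section

namespace HeisenbergLp

/-- The weighted norm `‖ f |x|^γ ‖_r` on `ℝ^d`, with values in `[0, ∞]`. -/
def weightedNorm {d : ℕ} (γ : ℝ) (r : ℝ≥0∞) (f : EuclideanSpace ℝ (Fin d) → ℂ) : ℝ≥0∞ :=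
  eLpNorm (fun x => (‖x‖ ^ γ) • f x) r volume

/-- `g` is (almost everywhere) the Fourier transform of `f ∈ L¹ + L²`: the Fourier integral
`∫ f(x) e^{-2πi⟨x,ξ⟩} dx` on `L¹`, the Plancherel extension on `L²`. -/
def IsFourierTransform {d : ℕ} (f g : EuclideanSpace ℝ (Fin d) → ℂ) : Prop :=
  ∃ (f₁ : EuclideanSpace ℝ (Fin d) → ℂ)
    (f₂ : Lp ℂ 2 (volume : Measure (EuclideanSpace ℝ (Fin d)))),
    Integrable f₁ volume ∧
    (∀ᵐ x ∂(volume : Measure (EuclideanSpace ℝ (Fin d))), f x = f₁ x + f₂ x) ∧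
    (∀ᵐ ξ ∂(volume : Measure (EuclideanSpace ℝ (Fin d))),
      g ξ = 𝓕 f₁ ξ + (𝓕 f₂ : Lp ℂ 2 (volume : Measure (EuclideanSpace ℝ (Fin d)))) ξ)

/-- `H(x) = sup { ‖f‖_q : ‖f |x|^α‖_q ≤ x, ‖f̂ |ξ|^β‖_p ≤ 1 }`, a supremum in `[0, ∞]`.
(The zero function contributes `0`, so it need not be excluded.) -/
def fourierH (d : ℕ) (p q : ℝ≥0∞) (α β x : ℝ) : ℝ≥0∞ :=
  ⨆ (f : EuclideanSpace ℝ (Fin d) → ℂ) (g : EuclideanSpace ℝ (Fin d) → ℂ)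
    (_ : IsFourierTransform f g)
    (_ : weightedNorm α q f ≤ ENNReal.ofReal x)
    (_ : weightedNorm β p g ≤ 1),
    eLpNorm f q volume

/-- Special Hadamard operators: linear operators `T` on `L²(ℝ^d)` such that
`‖Tf‖_∞ ≤ ‖f‖_1` for `f ∈ L¹ ∩ L²`, `‖Tf‖_2 ≤ ‖f‖_2`, and `T* = T⁻¹`. -/
structure IsSpecialHadamard {d : ℕ}
    (T : Lp ℂ 2 (volume : Measure (EuclideanSpace ℝ (Fin d))) →L[ℂ]
      Lp ℂ 2 (volume : Measure (EuclideanSpace ℝ (Fin d)))) : Prop where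
  sup_le : ∀ f : Lp ℂ 2 (volume : Measure (EuclideanSpace ℝ (Fin d))),
    Integrable f volume → eLpNorm (T f) ∞ volume ≤ eLpNorm f 1 volume
  norm_le : ∀ f : Lp ℂ 2 (volume : Measure (EuclideanSpace ℝ (Fin d))), ‖T f‖ ≤ ‖f‖
  adjoint_comp : (ContinuousLinearMap.adjoint T).comp T = ContinuousLinearMap.id ℂ _
  comp_adjoint : T.comp (ContinuousLinearMap.adjoint T) = ContinuousLinearMap.id ℂ _

/-- `sup_T sup { ‖Tf‖_q : ‖Tf |x|^α‖_q ≤ x, ‖f |ξ|^β‖_p ≤ 1 }` over all special Hadamard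
operators `T` and all `f ∈ L¹ ∩ L²`. -/
def hadamardSup (d : ℕ) (p q : ℝ≥0∞) (α β x : ℝ) : ℝ≥0∞ :=
  ⨆ (T : Lp ℂ 2 (volume : Measure (EuclideanSpace ℝ (Fin d))) →L[ℂ]
      Lp ℂ 2 (volume : Measure (EuclideanSpace ℝ (Fin d))))
    (_ : IsSpecialHadamard T)
    (f : Lp ℂ 2 (volume : Measure (EuclideanSpace ℝ (Fin d))))
    (_ : Integrable f volume)
    (_ : weightedNorm α q (T f) ≤ ENNReal.ofReal x)
    (_ : weightedNorm β p f ≤ 1),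
    eLpNorm (T f) q volume

/-- `sup_T sup { ‖f‖_q : ‖f |x|^α‖_q ≤ x, ‖Tf |ξ|^β‖_p ≤ 1 }` over all special Hadamard
operators `T` and all `f ∈ L¹ ∩ L²`. -/
def hadamardSup' (d : ℕ) (p q : ℝ≥0∞) (α β x : ℝ) : ℝ≥0∞ :=
  ⨆ (T : Lp ℂ 2 (volume : Measure (EuclideanSpace ℝ (Fin d))) →L[ℂ]
      Lp ℂ 2 (volume : Measure (EuclideanSpace ℝ (Fin d))))
    (_ : IsSpecialHadamard T)
    (f : Lp ℂ 2 (volume : Measure (EuclideanSpace ℝ (Fin d))))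
    (_ : Integrable f volume)
    (_ : weightedNorm α q f ≤ ENNReal.ofReal x)
    (_ : weightedNorm β p (T f) ≤ 1),
    eLpNorm f q volume

end HeisenbergLp

end

/-! The thresholds used are `β₀ = d`, `q₀ = 8d`, `α₀ = 1/8`.

Finiteness of `H` rests on an a priori sup bound for `f` (`IsFourierTransform.ae_enorm_le`,
`fourierH_lt_top`). Split `f̂` with a smooth cutoff. The high frequencies are integrable by Hölder,
since `|ξ|^(-β)` away from the origin lies in every `L^{p'}` when `β > d`. The low frequencies are a
convolution of `f` with a Schwartz function, bounded by Hölder, since `|y|^(-α)` near the origin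
lies in `L^{q'}` when `α q' < d`. A bounded function has controlled `L^q` norm on the unit ball, and
off that ball the weight `|x|^α` is at least one.

Blow-up: this argument uses convolution, and a special Hadamard operator need not respect it. Let
`m(y) = ∑ c_n e^{2πi n⟨w,y⟩}` be unimodular with absolutely summable coefficients, let `A` be a set
invariant under translation by `w`, and put `Tf = 1_A 𝓕f + 1_{Aᶜ} 𝓕(mf)` (`hadamardOp`). Each value
of `Tf` is a value of a Fourier transform of `f` or of `mf`, hence the `L¹`–`L^∞` bound. On the
Fourier side `m` acts by translations along multiples of `w`, which commute with restriction to `A`;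
hence `T` is unitary (`isSpecialHadamard_hadamardOp`), and its adjoint also satisfies the sup bound.

Now let `𝓕f = h` be a wide bump of height `M`, let `|w|` be the diameter of a ball containing its
support, and let `A` be the union of small balls about the multiples of `w`. Then `Tf` equals `M` on
one small ball and elsewhere consists of disjoint translates of `h` multiplied by the `c_n`. If the
`c_n` are tiny with some polynomial decay, this remainder is negligible in the weighted norm for
large `q`. The weight `|x|^α` makes the peak cheap, while the width of `h` makes `‖f |·|^β‖_p` small
(`exists_isSpecialHadamard_large`). The second supremum follows by using `T*` and `Tf`.

What remains is a flat unimodular series (`exists_flat_unimodular_series`): a discretised quadratic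
phase spreads its Fourier mass over about `N³` frequencies without resonance. -/

noncomputable section

namespace HeisenbergLp

/-! ### Unimodular trigonometric series with uniformly small coefficients -/

/-- A continuous piecewise linear phase, of slope `N² j` on `[j / N, (j + 1) / N]`. -/
def kinkPhase (N : ℕ) (t : ℝ) : ℝ :=
  ∑ i ∈ Finset.range N, (N : ℝ) ^ 2 * max 0 (t - (i + 1) / N)

/-- The unimodular function with phase `kinkPhase`. -/
def chirp (N : ℕ) (t : ℝ) : ℂ := Complex.exp (2 * Real.pi * Complex.I * kinkPhase N t)

lemma continuous_chirp (N : ℕ) : Continuous (chirp N) := by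
  unfold chirp kinkPhase
  fun_prop

lemma norm_chirp (N : ℕ) (t : ℝ) : ‖chirp N t‖ = 1 := by
  unfold chirp
  have : (2 * Real.pi * Complex.I * kinkPhase N t : ℂ)
      = ((2 * Real.pi * kinkPhase N t : ℝ) : ℂ) * Complex.I := by push_cast; ring
  rw [this, Complex.norm_exp_ofReal_mul_I]

lemma exp_two_pi_I_add_int (a : ℝ) (m : ℤ) :
    Complex.exp (2 * Real.pi * Complex.I * ((a + m : ℝ) : ℂ))
      = Complex.exp (2 * Real.pi * Complex.I * (a : ℂ)) := by
  push_cast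
  rw [mul_add, Complex.exp_add]
  have : (2 * Real.pi * Complex.I * (m : ℂ)) = m * (2 * Real.pi * Complex.I) := by ring
  rw [this, Complex.exp_int_mul_two_pi_mul_I, mul_one]

/-- A kink at `(i + 1)/N` shifts the phase by `N² (i + 1)/N = N (i + 1)`, an integer, so each linear
piece has intercept zero modulo one. The case `j = N` is allowed in order to reach the endpoint `t =
1`. -/
lemma kinkPhase_eq {N : ℕ} (hN : 0 < N) {j : ℕ} (hj : j ≤ N) {t : ℝ}
    (h1 : (j : ℝ) / N ≤ t) (h2 : t ≤ (j + 1) / N) :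
    kinkPhase N t = N ^ 2 * j * t + ((-(N * ∑ i ∈ Finset.range j, ((i : ℤ) + 1)) : ℤ) : ℝ) := by
  have hN' : (0 : ℝ) < N := by exact_mod_cast hN
  unfold kinkPhase
  rw [← Finset.sum_range_add_sum_Ico _ hj]
  have hz : ∑ i ∈ Finset.Ico j N, (N : ℝ) ^ 2 * max 0 (t - (i + 1) / N) = 0 := by
    refine Finset.sum_eq_zero fun i hi => ?_
    have hi' : (j : ℝ) ≤ i := by exact_mod_cast (Finset.mem_Ico.1 hi).1
    have : ((j : ℝ) + 1) / N ≤ (i + 1) / N := by gcongr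
    rw [max_eq_left (by linarith), mul_zero]
  have hs : ∑ i ∈ Finset.range j, (N : ℝ) ^ 2 * max 0 (t - (i + 1) / N)
      = ∑ i ∈ Finset.range j, ((N : ℝ) ^ 2 * t - N * ((i : ℝ) + 1)) := by
    refine Finset.sum_congr rfl fun i hi => ?_
    have hi' : (i : ℝ) + 1 ≤ j := by exact_mod_cast Finset.mem_range.1 hi
    have : ((i : ℝ) + 1) / N ≤ j / N := by gcongr
    rw [max_eq_right (by linarith)]
    field_simp
  rw [hz, hs, Finset.sum_sub_distrib, Finset.sum_const, Finset.card_range, ← Finset.mul_sum,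
    nsmul_eq_mul]
  push_cast
  ring

lemma chirp_eq {N : ℕ} (hN : 0 < N) {j : ℕ} (hj : j ≤ N) {t : ℝ}
    (h1 : (j : ℝ) / N ≤ t) (h2 : t ≤ (j + 1) / N) :
    chirp N t = Complex.exp (2 * Real.pi * Complex.I * ((N ^ 2 * j * t : ℝ) : ℂ)) := by
  rw [chirp, kinkPhase_eq hN hj h1 h2, exp_two_pi_I_add_int]

lemma chirp_zero {N : ℕ} (hN : 0 < N) : chirp N 0 = 1 := by
  rw [chirp_eq hN (Nat.zero_le N) (by simp) (by positivity)]; simp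

lemma chirp_one {N : ℕ} (hN : 0 < N) : chirp N 1 = 1 := by
  have hN' : (0 : ℝ) < N := by exact_mod_cast hN
  rw [chirp_eq hN le_rfl (by rw [div_self hN'.ne']) (by rw [le_div_iff₀ hN']; linarith)]
  have := exp_two_pi_I_add_int 0 (N ^ 3)
  simp only [zero_add, Complex.ofReal_zero, mul_zero, Complex.exp_zero] at this
  rw [← this]
  congr 2; push_cast; ring

/-- The contribution of `[j / N, (j + 1) / N]` to the `n`-th Fourier coefficient of `chirp N`. -/
def chirpPiece (N : ℕ) (n : ℤ) (j : ℕ) : ℂ :=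
  ∫ t in ((j : ℝ) / N)..((j + 1 : ℕ) : ℝ) / N,
    Complex.exp (2 * Real.pi * Complex.I * ((N ^ 2 * j - n : ℝ) : ℂ) * t)

/-- The Fourier coefficients of `chirp N`. -/
def chirpCoeff (N : ℕ) (n : ℤ) : ℂ := ∑ j ∈ Finset.range N, chirpPiece N n j

lemma norm_chirpPiece_le {N : ℕ} (hN : 0 < N) (n : ℤ) (j : ℕ) :
    ‖chirpPiece N n j‖ ≤ 1 / N := by
  have hN' : (0 : ℝ) < N := by exact_mod_cast hN
  refine (intervalIntegral.norm_integral_le_of_norm_le_const (C := 1) fun t _ => ?_).trans ?_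
  · have : (2 * Real.pi * Complex.I * ((N ^ 2 * j - n : ℝ) : ℂ) * t : ℂ)
      = ((2 * Real.pi * (N ^ 2 * j - n : ℝ) * t : ℝ) : ℂ) * Complex.I := by push_cast; ring
    rw [this, Complex.norm_exp_ofReal_mul_I]
  · rw [one_mul, ← sub_div]
    push_cast
    rw [add_sub_cancel_left, abs_of_pos (by positivity)]

/-- At a node `j/N` the quadratic contribution `N² j · j/N` is an integer and disappears, and
likewise at `(j + 1)/N`. The boundary terms then depend on `j` only through `n j/N`, so that they
telescope over `j`. -/
lemma chirpPiece_eq {N : ℕ} (hN : 0 < N) {n : ℤ} {j : ℕ} (h : (N ^ 2 * j - n : ℝ) ≠ 0) :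
    chirpPiece N n j = (Complex.exp (2 * Real.pi * Complex.I * ((-(n * (j + 1 : ℕ) / N) : ℝ) : ℂ))
      - Complex.exp (2 * Real.pi * Complex.I * ((-(n * j / N) : ℝ) : ℂ)))
        * (1 / (2 * Real.pi * Complex.I * ((N ^ 2 * j - n : ℝ) : ℂ))) := by
  have hN' : (N : ℝ) ≠ 0 := by exact_mod_cast hN.ne'
  have hN'' : (N : ℂ) ≠ 0 := by exact_mod_cast hN.ne'
  have hc : (2 * Real.pi * Complex.I * ((N ^ 2 * j - n : ℝ) : ℂ) : ℂ) ≠ 0 := by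
    simp only [ne_eq, mul_eq_zero, not_or]
    exact ⟨⟨⟨two_ne_zero, by exact_mod_cast Real.pi_ne_zero⟩, Complex.I_ne_zero⟩,
      by exact_mod_cast h⟩
  rw [chirpPiece, integral_exp_mul_complex hc, div_eq_mul_one_div]
  congr 2
  · rw [← exp_two_pi_I_add_int (-(n * (j + 1 : ℕ) / N)) (N * j * (j + 1))]
    congr 1
    push_cast; field_simp; ring
  · rw [← exp_two_pi_I_add_int (-(n * j / N)) (N * j * j)]
    congr 1
    push_cast; field_simp; ring

lemma norm_exp_two_pi_I (a : ℝ) : ‖Complex.exp (2 * Real.pi * Complex.I * (a : ℂ))‖ = 1 := by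
  have : (2 * Real.pi * Complex.I * a : ℂ)
      = ((2 * Real.pi * a : ℝ) : ℂ) * Complex.I := by push_cast; ring
  rw [this, Complex.norm_exp_ofReal_mul_I]

lemma norm_chirpPiece_le' {N : ℕ} (hN : 0 < N) {n : ℤ} {j : ℕ}
    (h : (N : ℝ) ^ 2 / 2 ≤ |(N ^ 2 * j - n : ℝ)|) : ‖chirpPiece N n j‖ ≤ 1 / N ^ 2 := by
  have hN' : (0 : ℝ) < N := by exact_mod_cast hN
  have h0 : (N ^ 2 * j - n : ℝ) ≠ 0 := by
    intro h0; rw [h0, abs_zero] at h; have : (0:ℝ) < N ^ 2 / 2 := by positivity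
    linarith
  rw [chirpPiece_eq hN h0, norm_mul]
  have h1 : ‖(1 / (2 * Real.pi * Complex.I * ((N ^ 2 * j - n : ℝ) : ℂ)) : ℂ)‖
      ≤ 1 / (2 * N ^ 2) := by
    rw [norm_div, norm_one, norm_mul, norm_mul, norm_mul, Complex.norm_I, Complex.norm_real,
      Complex.norm_real]
    simp only [Complex.norm_ofNat, mul_one, Real.norm_eq_abs, abs_of_pos Real.pi_pos]
    refine one_div_le_one_div_of_le (by positivity) ?_
    nlinarith [Real.pi_gt_three, sq_nonneg (N : ℝ)]
  calc _ ≤ (1 + 1) * (1 / (2 * (N : ℝ) ^ 2)) := by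
        gcongr
        refine (norm_sub_le _ _).trans (le_of_eq ?_)
        rw [norm_exp_two_pi_I, norm_exp_two_pi_I]
    _ = _ := by field_simp; norm_num

/-- The slopes `N² j` are `N²` apart, so at most one lies within `N²/2` of `n`. That resonant piece
costs its length `1/N`; the others cost at most `1/N²` each. -/
lemma norm_chirpCoeff_le {N : ℕ} (hN : 0 < N) (n : ℤ) : ‖chirpCoeff N n‖ ≤ 2 / N := by
  have hN' : (0 : ℝ) < N := by exact_mod_cast hN
  refine (norm_sum_le _ _).trans ?_
  by_cases hex : ∃ j ∈ Finset.range N, |(N ^ 2 * j - n : ℝ)| < (N : ℝ) ^ 2 / 2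
  · obtain ⟨j, hj, hjn⟩ := hex
    rw [← Finset.add_sum_erase _ _ hj]
    have : ∑ x ∈ (Finset.range N).erase j, ‖chirpPiece N n x‖
        ≤ ((Finset.range N).erase j).card • (1 / (N : ℝ) ^ 2) := by
      refine Finset.sum_le_card_nsmul _ _ _ fun i hi => norm_chirpPiece_le' hN ?_
      have hij : (1 : ℝ) ≤ |(i : ℝ) - j| := by
        have : (1 : ℤ) ≤ |(i : ℤ) - j| := by
          have := Finset.ne_of_mem_erase hi
          exact Int.one_le_abs (by omega)
        exact_mod_cast this
      have h1 : |(N : ℝ) ^ 2 * i - N ^ 2 * j| = N ^ 2 * |(i : ℝ) - j| := by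
        rw [← mul_sub, abs_mul, abs_of_pos (by positivity)]
      have h2 : (N : ℝ) ^ 2 ≤ N ^ 2 * |(i : ℝ) - j| := le_mul_of_one_le_right (by positivity) hij
      have h3 := abs_sub_le ((N : ℝ) ^ 2 * i) n (N ^ 2 * j)
      rw [abs_sub_comm (n : ℝ)] at h3
      linarith
    have hc : ((((Finset.range N).erase j).card : ℕ) : ℝ) ≤ N := by
      have := Finset.card_erase_le (s := Finset.range N) (a := j)
      rw [Finset.card_range] at this
      exact_mod_cast this
    calc _ ≤ 1 / (N : ℝ) + N * (1 / N ^ 2) := by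
          refine add_le_add (norm_chirpPiece_le hN n j) (this.trans ?_)
          rw [nsmul_eq_mul]
          gcongr
      _ = _ := by field_simp; norm_num
  · push Not at hex
    calc _ ≤ (Finset.range N).card • (1 / (N : ℝ) ^ 2) :=
          Finset.sum_le_card_nsmul _ _ _ fun i hi => norm_chirpPiece_le' hN (hex i hi)
      _ = 1 / N := by rw [Finset.card_range, nsmul_eq_mul]; field_simp
      _ ≤ _ := by gcongr; norm_num

/-- Continuity and periodicity of the chirp give a decay `n⁻²`: the boundary terms `u (j + 1) - u j`
add up to zero, so the factor `v j`, of size `1/n`, may be replaced by `v j - v 0`, of size `N³/n²`.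
-/
lemma norm_chirpCoeff_le' {N : ℕ} (hN : 0 < N) {n : ℤ} (hn : 2 * (N : ℝ) ^ 3 ≤ |(n : ℝ)|) :
    ‖chirpCoeff N n‖ ≤ N ^ 4 / (n : ℝ) ^ 2 := by
  have hN' : (0 : ℝ) < N := by exact_mod_cast hN
  have hn0 : 0 < |(n : ℝ)| := lt_of_lt_of_le (by positivity) hn
  set u : ℕ → ℂ := fun j => Complex.exp (2 * Real.pi * Complex.I * ((-(n * j / N) : ℝ) : ℂ))
    with hu
  set v : ℕ → ℂ := fun j => 1 / (2 * Real.pi * Complex.I * ((N ^ 2 * j - n : ℝ) : ℂ)) with hv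
  have hlow : ∀ j ∈ Finset.range N, |(n : ℝ)| / 2 ≤ |(N ^ 2 * j - n : ℝ)| := by
    intro j hj
    have hj' : (j : ℝ) ≤ N := by exact_mod_cast (Finset.mem_range.1 hj).le
    have h1 : |(N : ℝ) ^ 2 * j| ≤ N ^ 3 := by
      rw [abs_of_nonneg (by positivity), pow_succ (N : ℝ) 2]; gcongr
    have h2 := abs_sub_abs_le_abs_sub (n : ℝ) (N ^ 2 * j)
    rw [abs_sub_comm] at h2
    linarith
  have hne : ∀ j ∈ Finset.range N, (N ^ 2 * j - n : ℝ) ≠ 0 := fun j hj h0 => by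
    have := hlow j hj; rw [h0, abs_zero] at this; linarith
  have hsum : chirpCoeff N n = ∑ j ∈ Finset.range N, (u (j + 1) - u j) * (v j - v 0) := by
    have h1 : ∑ j ∈ Finset.range N, (u (j + 1) - u j) * v 0 = 0 := by
      rw [← Finset.sum_mul, Finset.sum_range_sub]
      have : u N = u 0 := by
        have := exp_two_pi_I_add_int 0 (-n)
        simp only [hu, Nat.cast_zero, mul_zero, zero_div, neg_zero]
        rw [← this]; congr 3; push_cast; field_simp; ring
      rw [this, sub_self, zero_mul]
    simp only [mul_sub, Finset.sum_sub_distrib, h1, sub_zero]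
    exact Finset.sum_congr rfl fun j hj => chirpPiece_eq hN (hne j hj)
  rw [hsum]
  refine (norm_sum_le _ _).trans ?_
  calc _ ≤ (Finset.range N).card • ((N : ℝ) ^ 3 / n ^ 2) := by
        refine Finset.sum_le_card_nsmul _ _ _ fun j hj => ?_
        have hj' : (j : ℝ) ≤ N := by exact_mod_cast (Finset.mem_range.1 hj).le
        have hu2 : ‖u (j + 1) - u j‖ ≤ 2 := by
          refine (norm_sub_le _ _).trans (le_of_eq ?_)
          simp only [hu]
          rw [norm_exp_two_pi_I, norm_exp_two_pi_I]; norm_num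
        have hn1 : (n : ℝ) ≠ 0 := abs_pos.1 hn0
        have hvv : v j - v 0 = ((-(N ^ 2 * j) / (2 * Real.pi * (N ^ 2 * j - n) * (-n)) : ℝ) : ℂ)
            * (1 / Complex.I) := by
          have h1 : ((N : ℂ) ^ 2 * j - n) ≠ 0 := by exact_mod_cast hne j hj
          have h2 : (n : ℂ) ≠ 0 := by exact_mod_cast hn1
          have h3 : (Real.pi : ℂ) ≠ 0 := by exact_mod_cast Real.pi_ne_zero
          simp only [hv]
          push_cast
          rw [mul_zero, zero_sub]
          field_simp
          ring
        have hI : ‖1 / Complex.I‖ = 1 := by simp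
        rw [norm_mul, hvv, norm_mul, Complex.norm_real, hI, mul_one, Real.norm_eq_abs, abs_div, abs_mul, abs_mul, abs_neg, abs_neg,
          abs_of_pos (show 0 < 2 * Real.pi by positivity),
          abs_of_nonneg (show 0 ≤ (N : ℝ) ^ 2 * j by positivity)]
        calc _ ≤ 2 * ((N : ℝ) ^ 2 * N / (2 * (|(n : ℝ)| / 2) * |(n : ℝ)| * 2)) := by
              gcongr ?_ * (?_ / ?_)
              · gcongr
              · have := hlow j hj
                have h4 : 2 * 2 * (|(n : ℝ)| / 2) ≤ 2 * Real.pi * |(N : ℝ) ^ 2 * j - n| := by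
                  gcongr
                  linarith [Real.pi_gt_three]
                nlinarith
          _ = _ := by
              rw [← sq_abs (n : ℝ)]
              field_simp
    _ = _ := by rw [Finset.card_range, nsmul_eq_mul]; ring

lemma summable_chirpCoeff {N : ℕ} (hN : 0 < N) : Summable (fun n => ‖chirpCoeff N n‖) := by
  have hs : Summable fun n : ℤ => (N : ℝ) ^ 4 / (n : ℝ) ^ 2 := by
    simpa [div_eq_mul_inv] using
      (Real.summable_one_div_int_pow.2 (one_lt_two)).mul_left ((N : ℝ) ^ 4)
  refine Summable.of_norm_bounded_eventually hs ?_
  rw [Filter.eventually_cofinite]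
  refine (Set.finite_Icc (-(2 * N ^ 3) : ℤ) (2 * N ^ 3)).subset fun n hn => ?_
  rw [Set.mem_ofPred_eq, norm_norm] at hn
  have : |(n : ℝ)| < 2 * (N : ℝ) ^ 3 := by
    by_contra! h
    exact hn (norm_chirpCoeff_le' hN h)
  have h2 : |n| < 2 * (N : ℤ) ^ 3 := by exact_mod_cast this
  rw [abs_lt] at h2
  exact ⟨h2.1.le, h2.2.le⟩

lemma integral_chirp {N : ℕ} (hN : 0 < N) (n : ℤ) :
    ∫ t in (0 : ℝ)..1, Complex.exp (2 * Real.pi * Complex.I * ((-n : ℤ) : ℂ) * t) * chirp N t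
      = chirpCoeff N n := by
  have hN' : (0 : ℝ) < N := by exact_mod_cast hN
  have hc := continuous_chirp N
  have := intervalIntegral.sum_integral_adjacent_intervals (μ := volume)
    (f := fun t : ℝ => Complex.exp (2 * Real.pi * Complex.I * ((-n : ℤ) : ℂ) * t) * chirp N t)
    (a := fun j : ℕ => (j : ℝ) / N) (n := N) (fun k _ => by
      apply Continuous.intervalIntegrable
      fun_prop)
  simp only [Nat.cast_zero, zero_div, div_self hN'.ne'] at this
  rw [← this]
  refine Finset.sum_congr rfl fun j hj => ?_
  refine intervalIntegral.integral_congr fun t ht => ?_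
  rw [Set.uIcc_of_le (by gcongr; simp)] at ht
  have h2 := ht.2
  push_cast at h2
  rw [chirp_eq hN (Finset.mem_range.1 hj).le ht.1 h2, ← Complex.exp_add]
  congr 1
  push_cast; ring

/-- Since the chirp takes the same value at `0` and `1`, it descends to a continuous function on the
circle; absolute summability of its coefficients then gives pointwise convergence. -/
lemma hasSum_chirpCoeff {N : ℕ} (hN : 0 < N) (t : ℝ) (ht : t ∈ Set.Ico (0 : ℝ) 1) :
    HasSum (fun n : ℤ => chirpCoeff N n * Complex.exp (2 * Real.pi * Complex.I * n * t))
      (chirp N t) := by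
  have : Fact ((0 : ℝ) < 1) := ⟨one_pos⟩
  have hc : Continuous (AddCircle.liftIco (1 : ℝ) 0 (chirp N)) :=
    AddCircle.liftIco_zero_continuous (by rw [chirp_zero hN, chirp_one hN])
      (continuous_chirp N).continuousOn
  let F : C(AddCircle (1 : ℝ), ℂ) := ⟨_, hc⟩
  have hF : fourierCoeff F = chirpCoeff N := by
    funext n
    change fourierCoeff (AddCircle.liftIco (1 : ℝ) 0 (chirp N)) n = _
    rw [fourierCoeff_liftIco_eq, fourierCoeffOn_eq_integral, ← integral_chirp hN]
    simp only [zero_add, sub_zero, div_one, one_smul, smul_eq_mul]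
    refine intervalIntegral.integral_congr fun t _ => ?_
    rw [fourier_coe_apply]
    simp
  have hs := has_pointwise_sum_fourier_series_of_summable (f := F)
    (by rw [hF]; exact (summable_chirpCoeff hN).of_norm) (t : AddCircle (1 : ℝ))
  rw [hF] at hs
  have hv : F (t : AddCircle (1 : ℝ)) = chirp N t :=
    show AddCircle.liftIco (1 : ℝ) 0 (chirp N) _ = _ from AddCircle.liftIco_zero_coe_apply ht
  rw [hv] at hs
  convert! hs using 2 with n
  rw [smul_eq_mul, fourier_coe_apply]
  simp

lemma norm_tsum_chirpCoeff {N : ℕ} (hN : 0 < N) (t : ℝ) :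
    ‖∑' n : ℤ, chirpCoeff N n * Complex.exp (2 * Real.pi * Complex.I * n * t)‖ = 1 := by
  rw [← norm_chirp N (Int.fract t),
    ← (hasSum_chirpCoeff hN (Int.fract t) ⟨Int.fract_nonneg t, Int.fract_lt_one t⟩).tsum_eq]
  congr 2
  funext n
  have := exp_two_pi_I_add_int (n * Int.fract t) (n * ⌊t⌋)
  congr 1
  have h2 : (n : ℝ) * Int.fract t + ((n * ⌊t⌋ : ℤ) : ℝ) = n * t := by
    push_cast; rw [← mul_add, Int.fract_add_floor]
  rw [h2] at this
  push_cast at this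
  rw [mul_assoc _ (n : ℂ), mul_assoc _ (n : ℂ), this]

/-- There are absolutely convergent trigonometric series of modulus one with coefficients
as small as desired, with a uniform polynomial decay. -/
theorem exists_flat_unimodular_series {η : ℝ} (hη : 0 < η) :
    ∃ c : ℤ → ℂ, Summable (fun n => ‖c n‖) ∧
      (∀ n : ℤ, ‖c n‖ ≤ η * (1 + |(n : ℝ)|) ^ (-(1 / 4) : ℝ)) ∧
      ∀ t : ℝ, ‖∑' n : ℤ, c n * Complex.exp (2 * Real.pi * Complex.I * n * t)‖ = 1 := by
  -- Both ranges of `n` below lead to a bound of `6 N^(-1/4)`, which is at most `η` for this choice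
  -- of `N`.
  obtain ⟨N, hNη⟩ := exists_nat_gt (max 1 ((6 / η) ^ 4))
  have hN1 : (1 : ℝ) < N := (le_max_left _ _).trans_lt hNη
  have hN : 0 < N := by exact_mod_cast (zero_lt_one.trans hN1)
  have hN' : (0 : ℝ) < N := by exact_mod_cast hN
  have hNq : 6 / η ≤ (N : ℝ) ^ (1 / 4 : ℝ) := by
    have := Real.rpow_le_rpow (by positivity) ((le_max_right _ _).trans hNη.le)
      (show (0 : ℝ) ≤ 1 / 4 by norm_num)
    rwa [← Real.rpow_natCast, ← Real.rpow_mul (by positivity), show ((4 : ℕ) : ℝ) * (1 / 4) = 1 by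
      norm_num, Real.rpow_one] at this
  have hNq' : 6 * (N : ℝ) ^ (-(1 / 4) : ℝ) ≤ η := by
    rw [Real.rpow_neg hN'.le, ← div_eq_mul_inv, div_le_iff₀ (by positivity)]
    rwa [div_le_iff₀ hη, mul_comm] at hNq
  refine ⟨chirpCoeff N, summable_chirpCoeff hN, fun n => ?_, norm_tsum_chirpCoeff hN⟩
  have h1n : (0 : ℝ) < 1 + |(n : ℝ)| := by positivity
  rw [Real.rpow_neg h1n.le, ← div_eq_mul_inv, le_div_iff₀ (by positivity)]
  refine le_trans ?_ hNq'
  -- For large `n` the `n⁻²` decay absorbs the weight. For small `n` the weight is `O(N^(3/4))`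
  -- against the flat bound `2/N`; here it matters that the exponent `1/4` is below `1/3`.
  rcases le_total (2 * (N : ℝ) ^ 3) |(n : ℝ)| with hn | hn
  · have hn1 : (1 : ℝ) ≤ |(n : ℝ)| := by
      have : (1 : ℝ) ≤ (N : ℝ) ^ 3 := one_le_pow₀ hN1.le
      linarith
    have hn0 : (0 : ℝ) < |(n : ℝ)| := by linarith
    have e1 : (1 + |(n : ℝ)|) ^ (1 / 4 : ℝ) ≤ 2 * |(n : ℝ)| ^ (1 / 4 : ℝ) := by
      calc _ ≤ (2 * |(n : ℝ)|) ^ (1 / 4 : ℝ) := by gcongr; linarith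
        _ = 2 ^ (1 / 4 : ℝ) * |(n : ℝ)| ^ (1 / 4 : ℝ) := Real.mul_rpow (by norm_num) hn0.le
        _ ≤ 2 ^ (1 : ℝ) * |(n : ℝ)| ^ (1 / 4 : ℝ) := by gcongr <;> norm_num
        _ = _ := by rw [Real.rpow_one]
    calc _ ≤ (N : ℝ) ^ 4 / (n : ℝ) ^ 2 * (2 * |(n : ℝ)| ^ (1 / 4 : ℝ)) := by
          gcongr; exact norm_chirpCoeff_le' hN hn
      _ = 2 * (N : ℝ) ^ 4 * |(n : ℝ)| ^ (-(7 / 4) : ℝ) := by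
          rw [← sq_abs, ← Real.rpow_natCast |(n : ℝ)| 2,
            show (-(7 / 4) : ℝ) = 1 / 4 - (2 : ℕ) by norm_num, Real.rpow_sub hn0]
          ring
      _ ≤ 2 * (N : ℝ) ^ 4 * ((N : ℝ) ^ 3) ^ (-(7 / 4) : ℝ) := by
          gcongr 2 * (N : ℝ) ^ 4 * ?_
          refine Real.rpow_le_rpow_of_nonpos (by positivity) ?_ (by norm_num)
          have : 0 < (N : ℝ) ^ 3 := by positivity
          linarith
      _ = 2 * (N : ℝ) ^ (-(5 / 4) : ℝ) := by
          rw [← Real.rpow_natCast, ← Real.rpow_natCast, ← Real.rpow_mul hN'.le, mul_assoc,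
            ← Real.rpow_add hN']
          norm_num
      _ ≤ _ := by
          have : (N : ℝ) ^ (-(5 / 4) : ℝ) ≤ (N : ℝ) ^ (-(1 / 4) : ℝ) :=
            Real.rpow_le_rpow_of_exponent_le hN1.le (by norm_num)
          have : 0 < (N : ℝ) ^ (-(1 / 4) : ℝ) := by positivity
          linarith
  · have hN3 : (1 : ℝ) ≤ (N : ℝ) ^ 3 := one_le_pow₀ hN1.le
    calc _ ≤ 2 / (N : ℝ) * (3 * (N : ℝ) ^ (3 / 4 : ℝ)) := by
          gcongr
          · exact norm_chirpCoeff_le hN n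
          · calc _ ≤ (3 * (N : ℝ) ^ 3) ^ (1 / 4 : ℝ) := by gcongr; linarith
              _ = 3 ^ (1 / 4 : ℝ) * ((N : ℝ) ^ 3) ^ (1 / 4 : ℝ) :=
                Real.mul_rpow (by norm_num) (by positivity)
              _ ≤ 3 ^ (1 : ℝ) * ((N : ℝ) ^ 3) ^ (1 / 4 : ℝ) := by gcongr <;> norm_num
              _ = _ := by
                rw [Real.rpow_one, ← Real.rpow_natCast, ← Real.rpow_mul hN'.le]; norm_num
      _ = 6 * (N : ℝ) ^ (-(1 / 4) : ℝ) := by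
          rw [show (-(1 / 4) : ℝ) = 3 / 4 - 1 by norm_num, Real.rpow_sub hN', Real.rpow_one]
          ring

/-! ### Fourier transforms on `L¹` and `L²`, tested against Schwartz functions -/

section Fourier

variable {E : Type*} [NormedAddCommGroup E] [InnerProductSpace ℝ E] [FiniteDimensional ℝ E]
  [MeasurableSpace E] [BorelSpace E]

open scoped SchwartzMap

lemma integral_fourier_mul_schwartz {f : E → ℂ} (hf : Integrable f) (ψ : 𝓢(E, ℂ)) :
    ∫ ξ, 𝓕 f ξ * ψ ξ = ∫ x, f x * 𝓕 ψ x := by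
  have := VectorFourier.integral_fourierIntegral_smul_eq_flip (μ := (volume : Measure E))
    (ν := (volume : Measure E)) (L := innerₗ E) Real.continuous_fourierChar continuous_inner hf
    ψ.integrable
  rw [flip_innerₗ] at this
  exact this

lemma integral_fourierInv_mul_schwartz {f : E → ℂ} (hf : Integrable f) (ψ : 𝓢(E, ℂ)) :
    ∫ ξ, 𝓕⁻ f ξ * ψ ξ = ∫ x, f x * 𝓕⁻ ψ x := by
  have := VectorFourier.integral_fourierIntegral_smul_eq_flip (μ := (volume : Measure E))
    (ν := (volume : Measure E)) (L := -innerₗ E) Real.continuous_fourierChar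
    (continuous_inner.neg) hf ψ.integrable
  have hfl : (-innerₗ E).flip = -innerₗ E := by
    ext x y; simp [real_inner_comm]
  rw [hfl] at this
  rw [SchwartzMap.fourierInv_coe]
  exact this

lemma integral_fourier_Lp_mul_schwartz (f : Lp ℂ 2 (volume : Measure E)) (ψ : 𝓢(E, ℂ)) :
    ∫ ξ, (𝓕 f : Lp ℂ 2 (volume : Measure E)) ξ * ψ ξ = ∫ x, f x * 𝓕 ψ x := by
  have := congrArg (fun u => u ψ) (Lp.fourier_toTemperedDistribution_eq f)
  simp only [TemperedDistribution.fourier_apply, Lp.toTemperedDistribution_apply,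
    smul_eq_mul] at this
  simp only [mul_comm _ (ψ _), mul_comm _ (𝓕 ψ _)]
  exact this.symm

lemma integral_fourierInv_Lp_mul_schwartz (f : Lp ℂ 2 (volume : Measure E)) (ψ : 𝓢(E, ℂ)) :
    ∫ ξ, (𝓕⁻ f : Lp ℂ 2 (volume : Measure E)) ξ * ψ ξ = ∫ x, f x * 𝓕⁻ ψ x := by
  have := congrArg (fun u => u ψ) (Lp.fourierInv_toTemperedDistribution_eq f)
  simp only [TemperedDistribution.fourierInv_apply, Lp.toTemperedDistribution_apply,
    smul_eq_mul] at this
  simp only [mul_comm _ (ψ _), mul_comm _ (𝓕⁻ ψ _)]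
  exact this.symm

/-- Locally integrable functions which agree against Schwartz functions agree almost everywhere. -/
lemma ae_eq_of_integral_mul_schwartz_eq {u v : E → ℂ} (hu : LocallyIntegrable u)
    (hv : LocallyIntegrable v)
    (h : ∀ ψ : 𝓢(E, ℂ), ∫ x, u x * ψ x = ∫ x, v x * ψ x) : u =ᵐ[volume] v := by
  refine ae_eq_of_integral_contDiff_smul_eq hu hv fun g hg hgs => ?_
  have hg' : ContDiff ℝ (⊤ : ℕ∞) (fun x => (g x : ℂ)) := Complex.ofRealCLM.contDiff.comp hg
  have hgs' : HasCompactSupport (fun x => (g x : ℂ)) := hgs.comp_left (g := Complex.ofReal) rfl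
  have := h (hgs'.toSchwartzMap hg')
  simpa only [HasCompactSupport.toSchwartzMap_toFun, mul_comm, Complex.real_smul
    ] using this

/-- Both transforms satisfy the same multiplication formula against Schwartz functions, which
determines a locally integrable function almost everywhere. -/
lemma fourier_Lp_ae_eq (f : Lp ℂ 2 (volume : Measure E)) (hf : Integrable f) :
    (𝓕 f : Lp ℂ 2 (volume : Measure E)) =ᵐ[volume] 𝓕 (f : E → ℂ) := by
  refine ae_eq_of_integral_mul_schwartz_eq
    ((Lp.memLp _).locallyIntegrable (by norm_num))
    (Continuous.locallyIntegrable ?_) fun ψ => ?_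
  · exact VectorFourier.fourierIntegral_continuous Real.continuous_fourierChar
      continuous_inner hf
  · rw [integral_fourier_Lp_mul_schwartz, integral_fourier_mul_schwartz hf]

lemma fourierInv_Lp_ae_eq (f : Lp ℂ 2 (volume : Measure E)) (hf : Integrable f) :
    (𝓕⁻ f : Lp ℂ 2 (volume : Measure E)) =ᵐ[volume] 𝓕⁻ (f : E → ℂ) := by
  refine ae_eq_of_integral_mul_schwartz_eq
    ((Lp.memLp _).locallyIntegrable (by norm_num))
    (Continuous.locallyIntegrable ?_) fun ψ => ?_
  · exact VectorFourier.fourierIntegral_continuous (L := -innerₗ E) Real.continuous_fourierChar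
      continuous_inner.neg hf
  · rw [integral_fourierInv_Lp_mul_schwartz, integral_fourierInv_mul_schwartz hf]

lemma norm_fourierInv_le (f : E → ℂ) (x : E) : ‖𝓕⁻ f x‖ ≤ ∫ y, ‖f y‖ :=
  VectorFourier.norm_fourierIntegral_le_integral_norm _ _ _ _ _

lemma norm_fourier_le (f : E → ℂ) (x : E) : ‖𝓕 f x‖ ≤ ∫ y, ‖f y‖ :=
  VectorFourier.norm_fourierIntegral_le_integral_norm _ _ _ _ _

end Fourier

/-! ### Multiplication operators on `L²` -/

section Multiplication

variable {α : Type*} [MeasurableSpace α] {μ : Measure α}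

lemma memLp_mul_of_norm_le_one {g : α → ℂ} (hg : Measurable g) (hb : ∀ x, ‖g x‖ ≤ 1)
    (f : Lp ℂ 2 μ) : MemLp (fun x => g x * f x) 2 μ :=
  (Lp.memLp f).of_le (hg.aestronglyMeasurable.mul (Lp.aestronglyMeasurable f))
    (ae_of_all _ fun x => by
      rw [norm_mul]; exact mul_le_of_le_one_left (norm_nonneg _) (hb x))

/-- Multiplication by a bounded measurable function, as an operator on `L²`. -/
def mulLp (μ : Measure α) (g : α → ℂ) (hg : Measurable g) (hb : ∀ x, ‖g x‖ ≤ 1) :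
    Lp ℂ 2 μ →L[ℂ] Lp ℂ 2 μ :=
  LinearMap.mkContinuous
    { toFun := fun f => (memLp_mul_of_norm_le_one hg hb f).toLp _
      map_add' := fun f h => by
        rw [← MemLp.toLp_add]
        refine MemLp.toLp_congr _ _ ?_
        filter_upwards [Lp.coeFn_add f h] with x hx
        simp only [Pi.add_apply, hx]; ring
      map_smul' := fun a f => by
        rw [RingHom.id_apply, ← MemLp.toLp_const_smul]
        refine MemLp.toLp_congr _ _ ?_
        filter_upwards [Lp.coeFn_smul a f] with x hx
        simp only [Pi.smul_apply, hx, smul_eq_mul]; ring }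
    1 fun f => by
      refine Lp.norm_le_mul_norm_of_ae_le_mul ?_
      filter_upwards [(memLp_mul_of_norm_le_one hg hb f).coeFn_toLp] with x hx
      change ‖((memLp_mul_of_norm_le_one hg hb f).toLp _ : Lp ℂ 2 μ) x‖ ≤ _
      rw [hx, norm_mul]
      gcongr
      exact hb x

lemma coeFn_mulLp (g : α → ℂ) (hg : Measurable g) (hb : ∀ x, ‖g x‖ ≤ 1) (f : Lp ℂ 2 μ) :
    mulLp μ g hg hb f =ᵐ[μ] fun x => g x * f x :=
  (memLp_mul_of_norm_le_one hg hb f).coeFn_toLp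

lemma mulLp_mul (g h : α → ℂ) (hg : Measurable g) (hgb : ∀ x, ‖g x‖ ≤ 1)
    (hh : Measurable h) (hhb : ∀ x, ‖h x‖ ≤ 1) (k : α → ℂ) (hk : Measurable k)
    (hkb : ∀ x, ‖k x‖ ≤ 1) (hghk : ∀ x, g x * h x = k x) :
    mulLp μ g hg hgb * mulLp μ h hh hhb = mulLp μ k hk hkb := by
  ext1 f
  refine Lp.ext ?_
  change mulLp μ g hg hgb (mulLp μ h hh hhb f) =ᵐ[μ] _
  filter_upwards [coeFn_mulLp g hg hgb (mulLp μ h hh hhb f), coeFn_mulLp h hh hhb f,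
    coeFn_mulLp k hk hkb f] with x h1 h2 h3
  rw [h1, h2, h3, ← hghk x, mul_assoc]

lemma mulLp_one (h : ∀ _ : α, ‖(1 : ℂ)‖ ≤ 1) : mulLp μ (fun _ => 1) measurable_const h = 1 := by
  ext1 f
  refine Lp.ext ?_
  filter_upwards [coeFn_mulLp (fun _ => 1) measurable_const h f] with x h1
  rw [h1, one_mul]; rfl

lemma star_mulLp (g h : α → ℂ) (hg : Measurable g) (hgb : ∀ x, ‖g x‖ ≤ 1)
    (hh : Measurable h) (hhb : ∀ x, ‖h x‖ ≤ 1) (hgh : ∀ x, h x = starRingEnd ℂ (g x)) :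
    star (mulLp μ g hg hgb) = mulLp μ h hh hhb := by
  rw [ContinuousLinearMap.star_eq_adjoint]
  symm
  rw [ContinuousLinearMap.eq_adjoint_iff]
  intro u v
  rw [L2.inner_def, L2.inner_def]
  refine integral_congr_ae ?_
  filter_upwards [coeFn_mulLp g hg hgb v, coeFn_mulLp h hh hhb u] with x h1 h2
  rw [h1, h2, hgh x]
  simp only [RCLike.inner_apply, map_mul, Complex.conj_conj]
  ring

/-- Absolutely convergent series of multipliers give strongly convergent series of
multiplication operators. -/
lemma hasSum_mulLp {c : ℤ → ℂ} (hc : Summable fun n => ‖c n‖) (χ : ℤ → α → ℂ)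
    (hχ : ∀ n, Measurable (χ n)) (hχb : ∀ n x, ‖χ n x‖ ≤ 1) (m : α → ℂ) (hm : Measurable m)
    (hmb : ∀ x, ‖m x‖ ≤ 1) (hmc : ∀ x, m x = ∑' n, c n * χ n x) (f : Lp ℂ 2 μ) :
    HasSum (fun n => c n • mulLp μ (χ n) (hχ n) (hχb n) f) (mulLp μ m hm hmb f) := by
  have hs (x : α) : Summable fun n => ‖c n * χ n x‖ :=
    Summable.of_nonneg_of_le (fun _ => norm_nonneg _)
      (fun n => by rw [norm_mul]; exact mul_le_of_le_one_right (norm_nonneg _) (hχb n x)) hc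
  rw [HasSum, SummationFilter.unconditional_filter, tendsto_iff_norm_sub_tendsto_zero]
  have ht : Filter.Tendsto (fun s : Finset ℤ => (∑' n, ‖c n‖ - ∑ n ∈ s, ‖c n‖) * ‖f‖)
      Filter.atTop (nhds 0) := by
    have := ((hc.hasSum.const_sub (∑' n, ‖c n‖)).mul_const ‖f‖)
    simpa using this
  refine squeeze_zero (fun _ => norm_nonneg _) (fun s => ?_) ht
  refine Lp.norm_le_mul_norm_of_ae_le_mul ?_
  have hall : ∀ᵐ x ∂μ, ∀ n, (c n • mulLp μ (χ n) (hχ n) (hχb n) f : Lp ℂ 2 μ) x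
      = c n * χ n x * f x := by
    rw [ae_all_iff]
    intro n
    filter_upwards [Lp.coeFn_smul (c n) (mulLp μ (χ n) (hχ n) (hχb n) f),
      coeFn_mulLp (χ n) (hχ n) (hχb n) f] with x h1 h2
    rw [h1, Pi.smul_apply, h2, smul_eq_mul, mul_assoc]
  filter_upwards [hall, coeFn_mulLp m hm hmb f,
    Lp.coeFn_sub (∑ n ∈ s, c n • mulLp μ (χ n) (hχ n) (hχb n) f) (mulLp μ m hm hmb f),
    Lp.coeFn_fun_finsetSum s fun n => c n • mulLp μ (χ n) (hχ n) (hχb n) f] with x h1 h2 h3 h4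
  rw [h3, Pi.sub_apply, h4, h2, Finset.sum_congr rfl fun n _ => h1 n, ← Finset.sum_mul, ← sub_mul,
    norm_mul]
  gcongr
  -- The multiplier error is the tail of the series outside `s`, dominated uniformly in `x` by the
  -- tail of `∑ ‖c n‖`.
  rw [hmc x, ← (hs x).of_norm.sum_add_tsum_subtype_compl s, ← hc.sum_add_tsum_subtype_compl s,
    add_sub_cancel_left, ← sub_sub, sub_self, zero_sub, norm_neg]
  refine (norm_tsum_le_tsum_norm ((hs x).subtype _)).trans ?_
  refine Summable.tsum_le_tsum (fun n => ?_) ((hs x).subtype _) (hc.subtype _)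
  rw [norm_mul]; exact mul_le_of_le_one_right (norm_nonneg _) (hχb n x)

end Multiplication

/-! ### Unitarity from a commutation relation -/

section StarAlgebra

variable {R : Type*} [Ring R] [StarRing R]

/-- With `U = F M F*` the operator factors as `(E + (1 - E) U) F`. As the projection `E` commutes
with `U`, the first factor is the identity on the range of `E` and `U` on the complementary range,
without cross terms. -/
lemma star_mul_self_of_commute {E F M : R} (hE : star E = E) (hEE : E * E = E)
    (hF : star F * F = 1) (hF' : F * star F = 1) (hM : star M * M = 1)
    (hc : E * (F * M * star F) = F * M * star F * E) :
    star (E * F + (1 - E) * F * M) * (E * F + (1 - E) * F * M) = 1 := by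
  set U := F * M * star F with hU
  have hUU : star U * U = 1 := by
    rw [hU, star_mul, star_mul, star_star]
    calc F * (star M * star F) * (F * M * star F)
        = F * star M * (star F * F) * M * star F := by noncomm_ring
      _ = F * (star M * M) * star F := by rw [hF]; noncomm_ring
      _ = 1 := by rw [hM, mul_one, hF']
  have hT : E * F + (1 - E) * F * M = (E + (1 - E) * U) * F := by
    have : U * F = F * M := by rw [hU, mul_assoc, hF, mul_one]
    rw [add_mul, mul_assoc (1 - E) U F, this, mul_assoc]
  have h1 : E * (1 - E) = 0 := by rw [mul_sub, mul_one, hEE, sub_self]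
  have h2 : (1 - E) * E = 0 := by rw [sub_mul, one_mul, hEE, sub_self]
  have h3 : (1 - E) * (1 - E) = 1 - E := by rw [mul_sub, mul_one, h2, sub_zero]
  have hc' : (1 - E) * U = U * (1 - E) := by rw [sub_mul, mul_sub, one_mul, mul_one, hc]
  have hK : star (E + (1 - E) * U) * (E + (1 - E) * U) = 1 := by
    rw [star_add, star_mul, star_sub, star_one, hE]
    calc (E + star U * (1 - E)) * (E + (1 - E) * U)
        = E * E + E * (1 - E) * U + star U * ((1 - E) * E) + star U * ((1 - E) * (1 - E) * U) := by
          noncomm_ring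
      _ = E + star U * (U * (1 - E)) := by rw [hEE, h1, h2, h3, hc']; simp
      _ = 1 := by rw [← mul_assoc, hUU, one_mul]; abel
  rw [hT, star_mul, mul_assoc, ← mul_assoc (star (E + _)), hK, one_mul, hF]

lemma mul_star_self_of_commute {E F M : R} (hE : star E = E) (hEE : E * E = E)
    (hF : star F * F = 1) (hF' : F * star F = 1) (hM : M * star M = 1)
    (hc : E * (F * M * star F) = F * M * star F * E) :
    (E * F + (1 - E) * F * M) * star (E * F + (1 - E) * F * M) = 1 := by
  set U := F * M * star F with hU
  have hUU : U * star U = 1 := by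
    rw [hU, star_mul, star_mul, star_star]
    calc F * M * star F * (F * (star M * star F))
        = F * M * (star F * F) * star M * star F := by noncomm_ring
      _ = F * (M * star M) * star F := by rw [hF]; noncomm_ring
      _ = 1 := by rw [hM, mul_one, hF']
  have hT : E * F + (1 - E) * F * M = (E + (1 - E) * U) * F := by
    have : U * F = F * M := by rw [hU, mul_assoc, hF, mul_one]
    rw [add_mul, mul_assoc (1 - E) U F, this, mul_assoc]
  have h1 : E * (1 - E) = 0 := by rw [mul_sub, mul_one, hEE, sub_self]
  have h2 : (1 - E) * E = 0 := by rw [sub_mul, one_mul, hEE, sub_self]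
  have hc' : (1 - E) * U = U * (1 - E) := by rw [sub_mul, mul_sub, one_mul, mul_one, hc]
  have hcs : E * star U = star U * E := by
    have := congrArg star hc
    rw [star_mul E U, star_mul U E, hE] at this
    exact this.symm
  have h4 : E * (star U * (1 - E)) = 0 := by rw [← mul_assoc, hcs, mul_assoc, h1, mul_zero]
  have h5 : (1 - E) * U * E = 0 := by rw [hc', mul_assoc, h2, mul_zero]
  have h3 : (1 - E) * (1 - E) = 1 - E := by rw [mul_sub, mul_one, h2, sub_zero]
  have hK : (E + (1 - E) * U) * star (E + (1 - E) * U) = 1 := by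
    rw [star_add, star_mul, star_sub, star_one, hE]
    calc (E + (1 - E) * U) * (E + star U * (1 - E))
        = E * E + E * (star U * (1 - E)) + (1 - E) * U * E
          + (1 - E) * (U * star U) * (1 - E) := by noncomm_ring
      _ = 1 := by rw [hEE, h4, h5, hUU, mul_one, h3]; abel
  rw [hT, star_mul, mul_assoc, ← mul_assoc F, hF', one_mul, hK]

end StarAlgebra

set_option linter.unusedSectionVars false

/-! ### Modulations, translations and sums of characters -/

section Modulation

variable {E : Type*} [NormedAddCommGroup E] [InnerProductSpace ℝ E] [FiniteDimensional ℝ E]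
  [MeasurableSpace E] [BorelSpace E]

open scoped SchwartzMap

/-- The Fourier transform on `L²` as a continuous linear map. -/
def fourierL2 (E : Type*) [NormedAddCommGroup E] [InnerProductSpace ℝ E] [FiniteDimensional ℝ E]
    [MeasurableSpace E] [BorelSpace E] :
    Lp ℂ 2 (volume : Measure E) →L[ℂ] Lp ℂ 2 (volume : Measure E) :=
  ((Lp.fourierTransformₗᵢ E ℂ).toContinuousLinearEquiv :
    Lp ℂ 2 (volume : Measure E) →L[ℂ] Lp ℂ 2 (volume : Measure E))

lemma fourierL2_apply (f : Lp ℂ 2 (volume : Measure E)) : fourierL2 E f = 𝓕 f := rfl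

lemma star_fourierL2_apply (f : Lp ℂ 2 (volume : Measure E)) : star (fourierL2 E) f = 𝓕⁻ f := by
  have : ContinuousLinearMap.adjoint (fourierL2 E) = _ :=
    (Lp.fourierTransformₗᵢ E ℂ).adjoint_eq_symm
  rw [ContinuousLinearMap.star_eq_adjoint, this]
  rfl

lemma star_fourierL2_mul_self : star (fourierL2 E) * fourierL2 E = 1 := by
  ext1 f
  change star (fourierL2 E) (fourierL2 E f) = f
  rw [star_fourierL2_apply, fourierL2_apply, FourierTransform.fourierInv_fourier_eq]

lemma fourierL2_mul_star_self : fourierL2 E * star (fourierL2 E) = 1 := by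
  ext1 f
  change fourierL2 E (star (fourierL2 E) f) = f
  rw [star_fourierL2_apply, fourierL2_apply, FourierTransform.fourier_fourierInv_eq]

/-- The character `y ↦ e^{2πi⟨a, y⟩}`. -/
def character (a y : E) : ℂ := Complex.exp (2 * Real.pi * Complex.I * (inner ℝ a y : ℝ))

lemma continuous_character (a : E) : Continuous (character a) := by
  unfold character; fun_prop

lemma norm_character (a y : E) : ‖character a y‖ = 1 := norm_exp_two_pi_I _

lemma fourier_character_mul (f : E → ℂ) (a ξ : E) :
    𝓕 (fun y => character a y * f y) ξ = 𝓕 f (ξ - a) := by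
  rw [Real.fourier_eq', Real.fourier_eq']
  refine integral_congr_ae (ae_of_all _ fun y => ?_)
  simp only [character, smul_eq_mul]
  rw [← mul_assoc, ← Complex.exp_add]
  congr 2
  rw [inner_sub_right, real_inner_comm y a]
  push_cast; ring

lemma measurable_character (a : E) : Measurable (character a) := (continuous_character a).measurable

/-- On the Fourier side, modulation is translation. -/
lemma fourierL2_mulLp_character (a : E) (f : Lp ℂ 2 (volume : Measure E)) :
    fourierL2 E (mulLp volume (character a) (measurable_character a)
      (fun y => (norm_character a y).le) f) =
    Lp.compMeasurePreservingₗᵢ ℂ (fun ξ => ξ - a) (measurePreserving_sub_right volume a)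
      (fourierL2 E f) := by
  have hd := SchwartzMap.denseRange_toLpCLM (E := E) (F := ℂ) (p := 2)
    (μ := volume) ENNReal.ofNat_ne_top
  -- Both sides are continuous in `f`, so it suffices to treat Schwartz functions, for which the
  -- transform is an honest integral.
  refine congrFun (hd.equalizer
    (g := fun f => fourierL2 E (mulLp volume (character a) (measurable_character a)
      (fun y => (norm_character a y).le) f))
    (h := fun f => Lp.compMeasurePreservingₗᵢ ℂ (fun ξ => ξ - a)
      (measurePreserving_sub_right volume a) (fourierL2 E f))
    ?_ ?_ ?_) f
  · fun_prop
  · exact (LinearIsometry.continuous _).comp (ContinuousLinearMap.continuous _)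
  · funext ψ
    simp only [Function.comp_apply, SchwartzMap.toLpCLM_apply]
    set f := ψ.toLp 2 (volume : Measure E) with hf
    have hfi : Integrable f := ψ.integrable.congr (ψ.coeFn_toLp 2 volume).symm
    have hm := coeFn_mulLp (μ := volume) (character a) (measurable_character a)
      (fun y => (norm_character a y).le) f
    have hmi : Integrable (mulLp volume (character a) (measurable_character a)
        (fun y => (norm_character a y).le) f) := by
      refine Integrable.congr ?_ hm.symm
      exact hfi.bdd_mul (c := 1) (measurable_character a).aestronglyMeasurable
        (ae_of_all _ fun y => (norm_character a y).le)
    refine Lp.ext ?_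
    have h1 := fourier_Lp_ae_eq _ hmi
    have h2 := (measurePreserving_sub_right volume a).quasiMeasurePreserving.ae_eq
      (fourier_Lp_ae_eq _ hfi)
    have h3 := Lp.coeFn_compMeasurePreserving (fourierL2 E f)
      (measurePreserving_sub_right (volume : Measure E) a)
    filter_upwards [h1, h2, h3] with ξ h1 h2 h3
    rw [fourierL2_apply, h1, Real.fourier_congr_ae hm, fourier_character_mul]
    exact h2.symm.trans h3.symm

variable (w : E) (c : ℤ → ℂ)

/-- The function `y ↦ ∑ c_n e^{2πi n ⟨w, y⟩}`. -/
def characterSum (y : E) : ℂ := ∑' n : ℤ, c n * character (n • w) y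

variable {c}

lemma continuous_characterSum (hc : Summable fun n => ‖c n‖) : Continuous (characterSum w c) := by
  refine continuous_tsum (fun n => continuous_const.mul (continuous_character _)) hc fun n y => ?_
  rw [norm_mul, norm_character, mul_one]

lemma norm_characterSum
    (hc1 : ∀ t : ℝ, ‖∑' n : ℤ, c n * Complex.exp (2 * Real.pi * Complex.I * n * t)‖ = 1) (y : E) :
    ‖characterSum w c y‖ = 1 := by
  rw [← hc1 (inner ℝ w y), characterSum]
  congr 3
  funext n
  rw [character]
  congr 2
  rw [← Int.cast_smul_eq_zsmul ℝ, real_inner_smul_left]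
  push_cast; ring

lemma fourier_characterSum_mul (hc : Summable fun n => ‖c n‖) {f : E → ℂ} (hf : Integrable f)
    (ξ : E) : 𝓕 (fun y => characterSum w c y * f y) ξ = ∑' n : ℤ, c n * 𝓕 f (ξ - n • w) := by
  have h1 (n : ℤ) : c n * 𝓕 f (ξ - n • w)
      = ∫ y, Complex.exp (↑(-2 * Real.pi * inner ℝ y ξ) * Complex.I) *
        (c n * (character (n • w) y * f y)) := by
    rw [← fourier_character_mul, Real.fourier_eq', ← integral_const_mul]
    refine integral_congr_ae (ae_of_all _ fun y => ?_)
    simp only [smul_eq_mul]; ring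
  have hn (n : ℤ) (y : E) : ‖Complex.exp (↑(-2 * Real.pi * inner ℝ y ξ) * Complex.I) *
        (c n * (character (n • w) y * f y))‖ = ‖c n‖ * ‖f y‖ := by
    rw [norm_mul, norm_mul, norm_mul, norm_character, Complex.norm_exp_ofReal_mul_I, one_mul,
      one_mul]
  simp only [h1]
  rw [integral_tsum_of_summable_integral_norm]
  · rw [Real.fourier_eq']
    refine integral_congr_ae (ae_of_all _ fun y => ?_)
    simp only [smul_eq_mul, characterSum]
    rw [tsum_mul_left, ← tsum_mul_right]
    simp only [mul_assoc]
  · intro n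
    refine (hf.norm.const_mul ‖c n‖).mono' ?_ (ae_of_all _ fun y => (hn n y).le)
    refine Continuous.aestronglyMeasurable (by fun_prop) |>.mul ?_
    exact ((continuous_character (n • w)).aestronglyMeasurable.mul hf.1).const_mul _
  · simp only [hn, integral_const_mul]
    exact hc.mul_right _

end Modulation

/-! ### The operator glued from `𝓕` and `𝓕` after modulation -/

section Hadamard

variable {E : Type*} [NormedAddCommGroup E] [InnerProductSpace ℝ E] [FiniteDimensional ℝ E]
  [MeasurableSpace E] [BorelSpace E]

open scoped SchwartzMap

/-- Multiplication by the indicator of a set, as an operator on `L²`. -/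
def restrictLp {A : Set E} (hA : MeasurableSet A) :
    Lp ℂ 2 (volume : Measure E) →L[ℂ] Lp ℂ 2 (volume : Measure E) :=
  mulLp volume (A.indicator fun _ => 1) (measurable_const.indicator hA)
    (fun x => by by_cases h : x ∈ A <;> simp [h])

lemma coeFn_restrictLp {A : Set E} (hA : MeasurableSet A) (f : Lp ℂ 2 (volume : Measure E)) :
    restrictLp hA f =ᵐ[volume] A.indicator f := by
  filter_upwards [coeFn_mulLp (μ := volume) (A.indicator fun _ => (1 : ℂ))
    (measurable_const.indicator hA) (fun x => by by_cases h : x ∈ A <;> simp [h]) f] with x hx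
  rw [restrictLp, hx]
  by_cases h : x ∈ A <;> simp [h]

lemma coeFn_one_sub_restrictLp {A : Set E} (hA : MeasurableSet A)
    (f : Lp ℂ 2 (volume : Measure E)) :
    (1 - restrictLp hA) f =ᵐ[volume] Aᶜ.indicator f := by
  change (f - restrictLp hA f : Lp ℂ 2 volume) =ᵐ[volume] _
  filter_upwards [Lp.coeFn_sub f (restrictLp hA f), coeFn_restrictLp hA f] with x h1 h2
  rw [h1, Pi.sub_apply, h2]
  by_cases h : x ∈ A <;> simp [h]

lemma star_restrictLp {A : Set E} (hA : MeasurableSet A) :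
    star (restrictLp hA) = restrictLp hA :=
  star_mulLp _ _ _ _ _ _ fun x => by by_cases h : x ∈ A <;> simp [h]

lemma restrictLp_mul_self {A : Set E} (hA : MeasurableSet A) :
    restrictLp hA * restrictLp hA = restrictLp hA :=
  mulLp_mul _ _ _ _ _ _ _ _ _ fun x => by by_cases h : x ∈ A <;> simp [h]

/-- The operator which is the Fourier transform of `f` on `A` and that of `m f` off `A`. -/
def hadamardOp {A : Set E} (hA : MeasurableSet A) {m : E → ℂ} (hm : Measurable m)
    (hmb : ∀ x, ‖m x‖ ≤ 1) :
    Lp ℂ 2 (volume : Measure E) →L[ℂ] Lp ℂ 2 (volume : Measure E) :=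
  restrictLp hA * fourierL2 E + (1 - restrictLp hA) * fourierL2 E * mulLp volume m hm hmb

variable {A : Set E} (hA : MeasurableSet A) {m : E → ℂ} (hm : Measurable m)
  (hmb : ∀ x, ‖m x‖ ≤ 1)

lemma integrable_mulLp {f : Lp ℂ 2 (volume : Measure E)} (hf : Integrable f) :
    Integrable (mulLp volume m hm hmb f) :=
  (hf.bdd_mul (c := 1) hm.aestronglyMeasurable (ae_of_all _ hmb)).congr
    (coeFn_mulLp m hm hmb f).symm

lemma hadamardOp_ae_eq {f : Lp ℂ 2 (volume : Measure E)} (hf : Integrable f) :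
    hadamardOp hA hm hmb f =ᵐ[volume]
      fun ξ => A.indicator (𝓕 (f : E → ℂ)) ξ + Aᶜ.indicator (𝓕 (fun y => m y * f y)) ξ := by
  change (restrictLp hA (fourierL2 E f) + (1 - restrictLp hA) (fourierL2 E
    (mulLp volume m hm hmb f)) : Lp ℂ 2 volume) =ᵐ[volume] _
  filter_upwards [Lp.coeFn_add (restrictLp hA (fourierL2 E f)) ((1 - restrictLp hA) (fourierL2 E
    (mulLp volume m hm hmb f))), coeFn_restrictLp hA (fourierL2 E f),
    coeFn_one_sub_restrictLp hA (fourierL2 E (mulLp volume m hm hmb f)), fourier_Lp_ae_eq f hf,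
    fourier_Lp_ae_eq _ (integrable_mulLp hm hmb hf)] with ξ h1 h2 h3 h4 h5
  rw [h1, Pi.add_apply, h2, h3]
  congr 1
  · by_cases h : ξ ∈ A
    · simp only [Set.indicator_of_mem h]; exact h4
    · simp only [Set.indicator_of_notMem h]
  · by_cases h : ξ ∈ Aᶜ
    · simp only [Set.indicator_of_mem h]
      exact h5.trans (Real.fourier_congr_ae (coeFn_mulLp m hm hmb f) ξ)
    · simp only [Set.indicator_of_notMem h]

lemma eLpNorm_one_eq_ofReal_integral {f : E → ℂ} (hf : Integrable f) :
    eLpNorm f 1 volume = ENNReal.ofReal (∫ x, ‖f x‖) := by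
  rw [eLpNorm_one_eq_lintegral_enorm, ofReal_integral_norm_eq_lintegral_enorm hf]

lemma eLpNorm_top_hadamardOp_le {f : Lp ℂ 2 (volume : Measure E)} (hf : Integrable f) :
    eLpNorm (hadamardOp hA hm hmb f) ∞ volume ≤ eLpNorm f 1 volume := by
  rw [eLpNorm_one_eq_ofReal_integral hf, eLpNorm_exponent_top]
  refine eLpNormEssSup_le_of_ae_bound ?_
  filter_upwards [hadamardOp_ae_eq hA hm hmb hf] with ξ hξ
  rw [hξ]
  by_cases h : ξ ∈ A
  · simp only [Set.indicator_of_mem h, Set.indicator_of_notMem (Set.notMem_compl_iff.2 h),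
      add_zero]
    exact norm_fourier_le _ _
  · simp only [Set.indicator_of_notMem h, Set.indicator_of_mem (Set.mem_compl h), zero_add]
    refine (norm_fourier_le _ _).trans (integral_mono_of_nonneg
      (ae_of_all _ fun y => norm_nonneg _) hf.norm (ae_of_all _ fun y => ?_))
    simp only [norm_mul]
    exact mul_le_of_le_one_left (norm_nonneg _) (hmb y)

lemma measurable_conj_comp {m : E → ℂ} (hm : Measurable m) :
    Measurable fun x => starRingEnd ℂ (m x) :=
  Complex.continuous_conj.measurable.comp hm

lemma norm_conj_le_one {m : E → ℂ} (hmb : ∀ x, ‖m x‖ ≤ 1) (x : E) : ‖starRingEnd ℂ (m x)‖ ≤ 1 := by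
  rw [RCLike.norm_conj]; exact hmb x

lemma star_hadamardOp : star (hadamardOp hA hm hmb) = star (fourierL2 E) * restrictLp hA
    + mulLp volume (fun x => starRingEnd ℂ (m x)) (measurable_conj_comp hm)
      (norm_conj_le_one hmb) * (star (fourierL2 E) * (1 - restrictLp hA)) := by
  rw [hadamardOp, star_add, star_mul, star_mul, star_mul, star_sub, star_one, star_restrictLp,
    star_mulLp m _ hm hmb (measurable_conj_comp hm) (norm_conj_le_one hmb)
      fun x => rfl]

/-- The adjoint sends `f` to `𝓕⁻(1_A f) + m̄ 𝓕⁻(1_{Aᶜ} f)`. The two terms are bounded by the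
integrals of `|f|` over `A` and `Aᶜ`, which add up to `‖f‖₁` exactly, so no constant is lost. -/
lemma eLpNorm_top_star_hadamardOp_le {f : Lp ℂ 2 (volume : Measure E)} (hf : Integrable f) :
    eLpNorm (star (hadamardOp hA hm hmb) f) ∞ volume ≤ eLpNorm f 1 volume := by
  rw [eLpNorm_one_eq_ofReal_integral hf, eLpNorm_exponent_top, star_hadamardOp]
  refine eLpNormEssSup_le_of_ae_bound ?_
  set m' := mulLp volume (fun x => starRingEnd ℂ (m x))
    (measurable_conj_comp hm) (norm_conj_le_one hmb)
  set f₁ := restrictLp hA f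
  set f₂ := (1 - restrictLp hA) f
  have hf₁ : Integrable f₁ := (hf.indicator hA).congr (coeFn_restrictLp hA f).symm
  have hf₂ : Integrable f₂ := (hf.indicator hA.compl).congr (coeFn_one_sub_restrictLp hA f).symm
  change ∀ᵐ x, ‖(star (fourierL2 E) f₁ + m' (star (fourierL2 E) f₂) : Lp ℂ 2 volume) x‖ ≤ _
  rw [star_fourierL2_apply, star_fourierL2_apply]
  filter_upwards [Lp.coeFn_add (𝓕⁻ f₁) (m' (𝓕⁻ f₂)), fourierInv_Lp_ae_eq f₁ hf₁,
    fourierInv_Lp_ae_eq f₂ hf₂, coeFn_mulLp (μ := volume) (fun x => starRingEnd ℂ (m x))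
    (measurable_conj_comp hm) (norm_conj_le_one hmb) (𝓕⁻ f₂)]
    with x h1 h2 h3 h4
  have e1 : ∫ y, ‖f₁ y‖ = ∫ y in A, ‖f y‖ := by
    rw [← integral_indicator hA]
    refine integral_congr_ae ?_
    filter_upwards [coeFn_restrictLp hA f] with y hy
    rw [hy, norm_indicator_eq_indicator_norm]
  have e2 : ∫ y, ‖f₂ y‖ = ∫ y in Aᶜ, ‖f y‖ := by
    rw [← integral_indicator hA.compl]
    refine integral_congr_ae ?_
    filter_upwards [coeFn_one_sub_restrictLp hA f] with y hy
    rw [hy, norm_indicator_eq_indicator_norm]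
  rw [h1, Pi.add_apply, h4, h2, h3, ← integral_add_compl hA hf.norm, ← e1, ← e2]
  refine (norm_add_le _ _).trans (add_le_add (norm_fourierInv_le _ _) ?_)
  rw [norm_mul]
  exact (mul_le_of_le_one_left (norm_nonneg _) (norm_conj_le_one hmb x)).trans
    (norm_fourierInv_le _ _)

/-- If `m` is an absolutely convergent series of characters whose frequencies leave `A`
invariant, then multiplication by `m` commutes, on the Fourier side, with restriction to `A`. -/
lemma restrictLp_commute {w : E} {c : ℤ → ℂ} (hc : Summable fun n => ‖c n‖)
    (hm : Measurable (characterSum w c)) (hmb : ∀ x, ‖characterSum w c x‖ ≤ 1)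
    (hAw : ∀ (n : ℤ) (ξ : E), ξ - n • w ∈ A ↔ ξ ∈ A) :
    restrictLp hA * (fourierL2 E * mulLp volume (characterSum w c) hm hmb * star (fourierL2 E))
      = fourierL2 E * mulLp volume (characterSum w c) hm hmb * star (fourierL2 E)
        * restrictLp hA := by
  set F := fourierL2 E
  set M := mulLp volume (characterSum w c) hm hmb
  let X : ℤ → (Lp ℂ 2 (volume : Measure E) →L[ℂ] Lp ℂ 2 (volume : Measure E)) := fun n =>
    mulLp volume (character (n • w)) (measurable_character _) fun y => (norm_character _ y).le
  have hS (f : Lp ℂ 2 (volume : Measure E)) : HasSum (fun n => c n • X n f) (M f) :=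
    hasSum_mulLp hc (fun n => character (n • w)) (fun n => measurable_character _)
      (fun n y => (norm_character _ y).le) (characterSum w c) hm hmb (fun _ => rfl) f
  have hcomm (n : ℤ) (f : Lp ℂ 2 (volume : Measure E)) :
      restrictLp hA (F (X n (star F f))) = F (X n (star F (restrictLp hA f))) := by
    have hFF (g : Lp ℂ 2 (volume : Measure E)) : F (star F g) = g :=
      congrArg (fun T => T g) (fourierL2_mul_star_self (E := E))
    simp only [X, F]
    rw [fourierL2_mulLp_character, fourierL2_mulLp_character, hFF, hFF]
    set τ := Lp.compMeasurePreservingₗᵢ (E := ℂ) (p := 2) ℂ (fun ξ : E => ξ - n • w)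
      (measurePreserving_sub_right volume (n • w))
    have hτ (g : Lp ℂ 2 (volume : Measure E)) : τ g =ᵐ[volume] fun ξ => g (ξ - n • w) :=
      Lp.coeFn_compMeasurePreserving g (measurePreserving_sub_right volume (n • w))
    refine Lp.ext ?_
    have h3 := (measurePreserving_sub_right volume (n • w)).quasiMeasurePreserving.ae_eq
      (coeFn_restrictLp hA f)
    filter_upwards [coeFn_restrictLp hA (τ f), hτ f, hτ (restrictLp hA f), h3] with ξ h1 h2 h3 h4
    rw [h1, h3]
    refine Eq.trans ?_ h4.symm
    simp only [Function.comp_apply]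
    by_cases h : ξ ∈ A
    · rw [Set.indicator_of_mem h, Set.indicator_of_mem ((hAw n ξ).2 h), h2]
    · rw [Set.indicator_of_notMem h, Set.indicator_of_notMem (mt (hAw n ξ).1 h)]
  ext1 f
  change restrictLp hA (F (M (star F f))) = F (M (star F (restrictLp hA f)))
  -- Bounded operators pass through the strongly convergent series, which reduces commutation with
  -- `M` to commutation with each single translation.
  have s1 := ((restrictLp hA).comp F).hasSum (hS (star F f))
  have s2 := F.hasSum (hS (star F (restrictLp hA f)))
  refine s1.unique ?_
  convert! s2 using 2 with n
  simp only [map_smul, ContinuousLinearMap.comp_apply, hcomm]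

end Hadamard

lemma isSpecialHadamard_of_star {d : ℕ}
    {T : Lp ℂ 2 (volume : Measure (EuclideanSpace ℝ (Fin d))) →L[ℂ]
      Lp ℂ 2 (volume : Measure (EuclideanSpace ℝ (Fin d)))}
    (h1 : star T * T = 1) (h2 : T * star T = 1)
    (hT : ∀ f : Lp ℂ 2 (volume : Measure (EuclideanSpace ℝ (Fin d))),
      Integrable f volume → eLpNorm (T f) ∞ volume ≤ eLpNorm f 1 volume) :
    IsSpecialHadamard T where
  sup_le := hT
  norm_le f := le_of_eq <| T.norm_map_iff_adjoint_comp_self.2 h1 f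
  adjoint_comp := h1
  comp_adjoint := h2

variable {d : ℕ} {A : Set (EuclideanSpace ℝ (Fin d))} (hA : MeasurableSet A)
  {w : EuclideanSpace ℝ (Fin d)} {c : ℤ → ℂ}

theorem isSpecialHadamard_hadamardOp (hc : Summable fun n => ‖c n‖)
    (hm : Measurable (characterSum w c)) (hm1 : ∀ x, ‖characterSum w c x‖ = 1)
    (hAw : ∀ (n : ℤ) ξ, ξ - n • w ∈ A ↔ ξ ∈ A) :
    IsSpecialHadamard (hadamardOp hA hm fun x => (hm1 x).le) ∧
      IsSpecialHadamard (star (hadamardOp hA hm fun x => (hm1 x).le)) := by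
  have hmb := fun x => (hm1 x).le
  have hcm := restrictLp_commute hA hc hm hmb hAw
  have hMs := star_mulLp (μ := volume) (characterSum w c) _ hm hmb
    (measurable_conj_comp hm) (norm_conj_le_one hmb) fun x => rfl
  have hnn (x) : starRingEnd ℂ (characterSum w c x) * characterSum w c x = 1 := by
    rw [mul_comm, Complex.mul_conj, Complex.normSq_eq_norm_sq, hm1]; norm_num
  have hM1 : star (mulLp volume (characterSum w c) hm hmb) * mulLp volume _ hm hmb = 1 := by
    rw [hMs, mulLp_mul _ _ _ _ _ _ (fun _ => 1) measurable_const (fun _ => by simp) hnn, mulLp_one]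
  have hM2 : mulLp volume _ hm hmb * star (mulLp volume (characterSum w c) hm hmb) = 1 := by
    rw [hMs, mulLp_mul _ _ _ _ _ _ (fun _ => 1) measurable_const (fun _ => by simp)
      fun x => by rw [mul_comm]; exact hnn x, mulLp_one]
  have h1 : star (hadamardOp hA hm hmb) * hadamardOp hA hm hmb = 1 :=
    star_mul_self_of_commute (star_restrictLp hA) (restrictLp_mul_self hA)
      star_fourierL2_mul_self fourierL2_mul_star_self hM1 hcm
  have h2 : hadamardOp hA hm hmb * star (hadamardOp hA hm hmb) = 1 :=
    mul_star_self_of_commute (star_restrictLp hA) (restrictLp_mul_self hA)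
      star_fourierL2_mul_self fourierL2_mul_star_self hM2 hcm
  refine ⟨isSpecialHadamard_of_star h1 h2 fun f hf => eLpNorm_top_hadamardOp_le hA hm hmb hf,
    isSpecialHadamard_of_star (by rwa [star_star]) (by rwa [star_star]) fun f hf =>
      eLpNorm_top_star_hadamardOp_le hA hm hmb hf⟩

/-! ### Polynomial decay and weighted norms of Schwartz functions -/

section Decay

variable {d : ℕ}

lemma memLp_one_add_norm_rpow {s : ℝ} (hs : 0 ≤ s) {p : ℝ≥0∞}
    (h : p ≠ 0 → p ≠ ∞ → (d : ℝ) < s * p.toReal) :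
    MemLp (fun x : EuclideanSpace ℝ (Fin d) => (1 + ‖x‖) ^ (-s)) p volume := by
  have hm : AEStronglyMeasurable (fun x : EuclideanSpace ℝ (Fin d) => (1 + ‖x‖) ^ (-s)) volume := by
    refine Continuous.aestronglyMeasurable ?_
    exact (continuous_const.add continuous_norm).rpow_const fun x =>
      Or.inl (add_pos_of_pos_of_nonneg one_pos (norm_nonneg x)).ne'
  by_cases hp0 : p = 0
  · rw [hp0, memLp_zero_iff_aestronglyMeasurable]; exact hm
  by_cases hp : p = ∞
  · rw [hp]
    refine memLp_top_of_bound hm 1 (ae_of_all _ fun x => ?_)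
    rw [Real.norm_of_nonneg (by positivity)]
    exact Real.rpow_le_one_of_one_le_of_nonpos (by linarith [norm_nonneg x]) (by linarith)
  rw [← integrable_norm_rpow_iff hm hp0 hp]
  refine (integrable_one_add_norm (μ := volume) (E := EuclideanSpace ℝ (Fin d))
    (r := s * p.toReal) (by simpa using h hp0 hp)).congr (ae_of_all _ fun x => ?_)
  have : 0 ≤ 1 + ‖x‖ := by positivity
  simp only
  rw [Real.norm_of_nonneg (by positivity), ← Real.rpow_mul this, neg_mul]

open scoped SchwartzMap

lemma exists_norm_schwartz_le (φ : 𝓢(EuclideanSpace ℝ (Fin d), ℂ)) (s : ℝ) :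
    ∃ C, 0 ≤ C ∧ ∀ x, ‖φ x‖ ≤ C * (1 + ‖x‖) ^ (-s) := by
  obtain ⟨k, hk⟩ := exists_nat_ge s
  refine ⟨2 ^ k * ((Finset.Iic (k, 0)).sup fun m => SchwartzMap.seminorm ℝ m.1 m.2) φ,
    by positivity, fun x => ?_⟩
  have h := SchwartzMap.one_add_le_sup_seminorm_apply (𝕜 := ℝ) (m := (k, 0)) le_rfl le_rfl φ x
  rw [norm_iteratedFDeriv_zero] at h
  have h1 : 0 < 1 + ‖x‖ := by positivity
  rw [Real.rpow_neg h1.le, ← div_eq_mul_inv, le_div_iff₀ (by positivity)]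
  refine le_trans ?_ h
  rw [mul_comm]
  gcongr
  rw [← Real.rpow_natCast]
  exact Real.rpow_le_rpow_of_exponent_le (by linarith [norm_nonneg x]) hk

lemma weightedNorm_schwartz_lt_top {β : ℝ} (hβ : 0 ≤ β) {p : ℝ≥0∞} (hp : 1 ≤ p)
    (φ : 𝓢(EuclideanSpace ℝ (Fin d), ℂ)) : weightedNorm β p φ < ∞ := by
  obtain ⟨C, hC, h⟩ := exists_norm_schwartz_le φ (β + (d + 1))
  have hd1 : (0 : ℝ) ≤ d + 1 := by positivity
  have hm := (memLp_one_add_norm_rpow (d := d) (p := p) hd1 (fun _ hpt => by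
    have : (1 : ℝ) ≤ p.toReal := by
      rw [← ENNReal.toReal_one]; exact ENNReal.toReal_mono hpt hp
    nlinarith)).const_mul C
  refine (hm.of_le ?_ (ae_of_all _ fun x => ?_)).2
  · refine Continuous.aestronglyMeasurable ?_
    exact (continuous_norm.rpow_const fun x => Or.inr hβ).smul φ.continuous
  · have h1 : 0 < 1 + ‖x‖ := by positivity
    rw [norm_smul, Real.norm_of_nonneg (by positivity), Real.norm_of_nonneg (by positivity)]
    calc ‖x‖ ^ β * ‖φ x‖ ≤ (1 + ‖x‖) ^ β * (C * (1 + ‖x‖) ^ (-(β + (d + 1)))) := by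
          gcongr
          · linarith
          · exact h x
      _ = C * (1 + ‖x‖) ^ (-((d : ℝ) + 1)) := by
          rw [mul_left_comm, ← Real.rpow_add h1]; congr 2; ring

end Decay

/-! ### Dilated bumps and their inverse Fourier transforms -/

section TestFunction

variable {d : ℕ}

open scoped SchwartzMap

/-- A smooth bump, equal to one on the unit ball and supported in the ball of radius two. -/
def unitBump (d : ℕ) : ContDiffBump (0 : EuclideanSpace ℝ (Fin d)) where
  rIn := 1
  rOut := 2
  rIn_pos := one_pos
  rIn_lt_rOut := one_lt_two

lemma hasCompactSupport_dilate_bump {ε : ℝ} (hε : ε ≠ 0) (M : ℝ) :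
    HasCompactSupport (fun ξ : EuclideanSpace ℝ (Fin d) => ((M * unitBump d (ε • ξ) : ℝ) : ℂ)) := by
  have h1 : HasCompactSupport (fun ξ : EuclideanSpace ℝ (Fin d) => unitBump d (ε • ξ)) :=
    (unitBump d).hasCompactSupport.comp_homeomorph (Homeomorph.smulOfNeZero ε hε)
  exact h1.comp_left (g := fun t : ℝ => ((M * t : ℝ) : ℂ)) (by simp)

lemma contDiff_dilate_bump (ε M : ℝ) :
    ContDiff ℝ (⊤ : ℕ∞)
      (fun ξ : EuclideanSpace ℝ (Fin d) => ((M * unitBump d (ε • ξ) : ℝ) : ℂ)) := by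
  refine Complex.ofRealCLM.contDiff.comp (contDiff_const.mul ?_)
  exact (unitBump d).contDiff.comp (contDiff_const_smul ε)

/-- The dilated bump `ξ ↦ M b(ε ξ)` as a Schwartz function. -/
def dilatedBump {ε : ℝ} (hε : ε ≠ 0) (M : ℝ) : 𝓢(EuclideanSpace ℝ (Fin d), ℂ) :=
  (hasCompactSupport_dilate_bump hε M).toSchwartzMap (contDiff_dilate_bump ε M)

lemma dilatedBump_apply {ε : ℝ} (hε : ε ≠ 0) (M : ℝ) (ξ : EuclideanSpace ℝ (Fin d)) :
    dilatedBump hε M ξ = ((M * unitBump d (ε • ξ) : ℝ) : ℂ) := rfl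

lemma fourierInv_dilatedBump {ε : ℝ} (hε : 0 < ε) (M : ℝ) (y : EuclideanSpace ℝ (Fin d)) :
    𝓕⁻ (dilatedBump hε.ne' M) y
      = (M * (ε ^ d)⁻¹ : ℝ) • 𝓕⁻ (dilatedBump (d := d) one_ne_zero 1) (ε⁻¹ • y) := by
  rw [SchwartzMap.fourierInv_coe, SchwartzMap.fourierInv_coe, Real.fourierInv_eq',
    Real.fourierInv_eq']
  have := Measure.integral_comp_smul (volume : Measure (EuclideanSpace ℝ (Fin d)))
    (fun v => Complex.exp (↑(2 * Real.pi * inner ℝ v (ε⁻¹ • y)) * Complex.I) •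
      dilatedBump (d := d) one_ne_zero 1 v) ε
  rw [finrank_euclideanSpace_fin, abs_of_pos (by positivity)] at this
  rw [mul_smul, ← this, ← integral_smul]
  refine integral_congr_ae (ae_of_all _ fun v => ?_)
  simp only [dilatedBump_apply, one_smul, one_mul]
  have h1 : inner ℝ (ε • v) (ε⁻¹ • y) = inner ℝ v y := by
    rw [real_inner_smul_left, real_inner_smul_right]; field_simp
  rw [h1]
  simp only [smul_eq_mul, Complex.real_smul]
  push_cast; ring

lemma eLpNorm_comp_inv_smul_le {F : Type*} [NormedAddCommGroup F]
    (G : EuclideanSpace ℝ (Fin d) → F) {ε : ℝ} (hε : 0 < ε) (hε1 : ε ≤ 1)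
    (hG : AEStronglyMeasurable G volume) (p : ℝ≥0∞) :
    eLpNorm (fun y => G (ε⁻¹ • y)) p volume ≤ eLpNorm G p volume := by
  have hmap := Measure.map_addHaar_smul (volume : Measure (EuclideanSpace ℝ (Fin d)))
    (inv_ne_zero hε.ne')
  have hle : Measure.map (ε⁻¹ • ·) (volume : Measure (EuclideanSpace ℝ (Fin d))) ≤ volume := by
    rw [hmap]
    refine Measure.le_iff.2 fun s _ => ?_
    rw [Measure.smul_apply, smul_eq_mul]
    refine mul_le_of_le_one_left (by positivity) ?_
    rw [finrank_euclideanSpace_fin, inv_pow, inv_inv, abs_of_pos (by positivity)]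
    exact ENNReal.ofReal_le_one.2 (pow_le_one₀ hε.le hε1)
  have hs : Measurable fun y : EuclideanSpace ℝ (Fin d) => ε⁻¹ • y := by fun_prop
  calc _ = eLpNorm G p (Measure.map (ε⁻¹ • ·) volume) :=
        (eLpNorm_map_measure (hG.mono_measure hle) hs.aemeasurable).symm
    _ ≤ _ := eLpNorm_mono_measure G hle

/-- Fourier scaling costs `ε^(-d)` in amplitude and the weight gains `ε^β`. The further gain from
the Jacobian in `L^p` is discarded, so the exponent `β - d` serves every `p`. -/
lemma weightedNorm_fourierInv_dilatedBump_le {ε : ℝ} (hε : 0 < ε) (hε1 : ε ≤ 1) {M : ℝ}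
    (hM : 0 ≤ M) {β : ℝ} (hβ : 0 ≤ β) (p : ℝ≥0∞) :
    weightedNorm β p (𝓕⁻ (dilatedBump hε.ne' M) : 𝓢(EuclideanSpace ℝ (Fin d), ℂ)) ≤
      ENNReal.ofReal (M * ε ^ (β - d)) *
        weightedNorm β p (𝓕⁻ (dilatedBump one_ne_zero 1) : 𝓢(EuclideanSpace ℝ (Fin d), ℂ)) := by
  set φ := 𝓕⁻ (dilatedBump (d := d) one_ne_zero 1)
  have h : (fun y : EuclideanSpace ℝ (Fin d) =>
      (‖y‖ ^ β) • 𝓕⁻ (dilatedBump (d := d) hε.ne' M) y)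
      = (M * ε ^ (β - d)) • fun y => (‖ε⁻¹ • y‖ ^ β) • φ (ε⁻¹ • y) := by
    funext y
    rw [fourierInv_dilatedBump hε, Pi.smul_apply, smul_smul, smul_smul, norm_smul,
      Real.norm_of_nonneg (by positivity), Real.mul_rpow (by positivity) (by positivity),
      Real.inv_rpow hε.le, Real.rpow_sub hε, Real.rpow_natCast]
    congr 1
    have : ε ^ β ≠ 0 := (Real.rpow_pos_of_pos hε β).ne'
    field_simp
  unfold weightedNorm
  rw [h, eLpNorm_const_smul, ← ofReal_norm, Real.norm_of_nonneg (by positivity)]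
  gcongr
  refine eLpNorm_comp_inv_smul_le (fun y => (‖y‖ ^ β) • φ y) hε hε1 ?_ p
  refine Continuous.aestronglyMeasurable ?_
  exact (continuous_norm.rpow_const fun x => Or.inr hβ).smul φ.continuous

end TestFunction

/-! ### Blow-up over special Hadamard operators -/

section BlowUp

variable {d : ℕ}

open scoped SchwartzMap

/-- The union of the balls of radius `r` around the integer multiples of `w`. -/
def ballChain (w : EuclideanSpace ℝ (Fin d)) (r : ℝ) : Set (EuclideanSpace ℝ (Fin d)) :=
  ⋃ n : ℤ, Metric.ball (n • w) r

lemma measurableSet_ballChain (w : EuclideanSpace ℝ (Fin d)) (r : ℝ) :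
    MeasurableSet (ballChain w r) :=
  MeasurableSet.iUnion fun _ => measurableSet_ball

lemma sub_zsmul_mem_ballChain (w : EuclideanSpace ℝ (Fin d)) (r : ℝ) (n : ℤ)
    (ξ : EuclideanSpace ℝ (Fin d)) : ξ - n • w ∈ ballChain w r ↔ ξ ∈ ballChain w r := by
  simp only [ballChain, Set.mem_iUnion, Metric.mem_ball, dist_eq_norm]
  constructor
  · rintro ⟨k, hk⟩
    exact ⟨k + n, by rwa [add_smul, add_comm, ← sub_sub]⟩
  · rintro ⟨k, hk⟩
    exact ⟨k - n, by rwa [sub_smul, sub_sub, add_sub_cancel]⟩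

lemma hadamardOp_fourierInv_ae_eq {A : Set (EuclideanSpace ℝ (Fin d))} (hA : MeasurableSet A)
    {w : EuclideanSpace ℝ (Fin d)} {c : ℤ → ℂ} (hc : Summable fun n => ‖c n‖)
    (hm : Measurable (characterSum w c)) (hmb : ∀ x, ‖characterSum w c x‖ ≤ 1)
    (h : 𝓢(EuclideanSpace ℝ (Fin d), ℂ)) :
    hadamardOp hA hm hmb ((𝓕⁻ h).toLp 2 volume) =ᵐ[volume] fun ξ =>
      A.indicator h ξ + Aᶜ.indicator (fun ξ => ∑' n : ℤ, c n * h (ξ - n • w)) ξ := by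
  have hae := (𝓕⁻ h).coeFn_toLp 2 (volume : Measure (EuclideanSpace ℝ (Fin d)))
  have hi : Integrable ((𝓕⁻ h).toLp 2 (volume : Measure (EuclideanSpace ℝ (Fin d)))) :=
    (𝓕⁻ h).integrable.congr hae.symm
  have h1 : 𝓕 (((𝓕⁻ h).toLp 2 (volume : Measure (EuclideanSpace ℝ (Fin d)))) :
      EuclideanSpace ℝ (Fin d) → ℂ) = h := by
    funext ξ
    rw [Real.fourier_congr_ae hae, ← SchwartzMap.fourier_coe,
      FourierTransform.fourier_fourierInv_eq]
  filter_upwards [hadamardOp_ae_eq hA hm hmb hi] with ξ hξ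
  rw [hξ, h1]
  congr 2
  funext ξ
  rw [fourier_characterSum_mul w hc hi, h1]

lemma integrable_hadamardOp_fourierInv {A : Set (EuclideanSpace ℝ (Fin d))} (hA : MeasurableSet A)
    {w : EuclideanSpace ℝ (Fin d)} {c : ℤ → ℂ} (hc : Summable fun n => ‖c n‖)
    (hm : Measurable (characterSum w c)) (hmb : ∀ x, ‖characterSum w c x‖ ≤ 1)
    (h : 𝓢(EuclideanSpace ℝ (Fin d), ℂ)) :
    Integrable (hadamardOp hA hm hmb ((𝓕⁻ h).toLp 2 volume)) := by
  have hs : Integrable fun ξ => ∑' n : ℤ, c n * h (ξ - n • w) := by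
    have hi (n : ℤ) : Integrable fun ξ => c n * h (ξ - n • w) :=
      (h.integrable.comp_sub_right _).const_mul _
    obtain ⟨C, hC0, hC⟩ := exists_norm_schwartz_le h 0
    have hb (n : ℤ) (ξ) : ‖c n * h (ξ - n • w)‖ ≤ ‖c n‖ * C := by
      rw [norm_mul]
      gcongr
      simpa using hC (ξ - n • w)
    refine ⟨(continuous_tsum (fun n => ?_) (hc.mul_right C) hb).aestronglyMeasurable, ?_⟩
    · exact continuous_const.mul (h.continuous.comp (continuous_id.sub continuous_const))
    · calc ∫⁻ ξ, ‖∑' n : ℤ, c n * h (ξ - n • w)‖ₑ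
          ≤ ∫⁻ ξ, ∑' n : ℤ, ‖c n * h (ξ - n • w)‖ₑ := lintegral_mono fun ξ =>
            enorm_tsum_le_tsum_enorm
        _ = ∑' n : ℤ, ‖c n‖ₑ * ∫⁻ ξ, ‖h ξ‖ₑ := by
          rw [lintegral_tsum fun n => (hi n).1.enorm]
          congr 1
          funext n
          simp only [enorm_mul]
          rw [lintegral_const_mul' _ _ enorm_ne_top,
            lintegral_sub_right_eq_self (fun ξ => ‖h ξ‖ₑ) (n • w)]
        _ < ∞ := by
          rw [ENNReal.tsum_mul_right]
          refine ENNReal.mul_lt_top ?_ h.integrable.2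
          have := hc.tsum_ofReal_lt_top
          simpa only [ofReal_norm] using this
  exact ((h.integrable.indicator hA).add (hs.indicator hA.compl)).congr
    (hadamardOp_fourierInv_ae_eq hA hc hm hmb h).symm

/-- As `‖w‖ = 2R`, the translates of the ball of radius `R` are disjoint and at most one term
survives. For that term `1 + ‖ξ‖ ≤ (1 + |n|)(1 + 2R)`, which converts decay in `n` into decay in
`ξ`. -/
lemma norm_tsum_translates_le {w : EuclideanSpace ℝ (Fin d)} {c : ℤ → ℂ} {R M η σ : ℝ}
    (hM : 0 ≤ M) (hη : 0 ≤ η) (hσ : 0 ≤ σ) (hR : 0 < R) (hw : ‖w‖ = 2 * R)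
    (hc : ∀ n : ℤ, ‖c n‖ ≤ η * (1 + |(n : ℝ)|) ^ (-σ)) {h : EuclideanSpace ℝ (Fin d) → ℂ}
    (hh : ∀ ξ, R ≤ ‖ξ‖ → h ξ = 0) (hhM : ∀ ξ, ‖h ξ‖ ≤ M) (ξ : EuclideanSpace ℝ (Fin d)) :
    ‖∑' n : ℤ, c n * h (ξ - n • w)‖ ≤ M * η * (1 + 2 * R) ^ σ * (1 + ‖ξ‖) ^ (-σ) := by
  by_cases hex : ∃ n : ℤ, ‖ξ - n • w‖ < R
  · obtain ⟨n, hn⟩ := hex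
    have hnw (k : ℤ) : ‖k • w‖ = |(k : ℝ)| * (2 * R) := by
      rw [← Int.cast_smul_eq_zsmul ℝ, norm_smul, hw, Real.norm_eq_abs]
    rw [tsum_eq_single n fun k hk => ?_]
    · have h1 : 1 + ‖ξ‖ ≤ (1 + |(n : ℝ)|) * (1 + 2 * R) := by
        have := norm_sub_norm_le ξ (n • w)
        rw [hnw] at this
        have : 0 ≤ |(n : ℝ)| := abs_nonneg _
        nlinarith
      have h2 : (1 + |(n : ℝ)|) ^ (-σ) ≤ (1 + 2 * R) ^ σ * (1 + ‖ξ‖) ^ (-σ) := by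
        have p1 : 0 < 1 + |(n : ℝ)| := by positivity
        have p2 : 0 < 1 + ‖ξ‖ := by positivity
        have p3 : 0 < 1 + 2 * R := by positivity
        rw [Real.rpow_neg p1.le, Real.rpow_neg p2.le, ← div_eq_mul_inv, le_div_iff₀ (by positivity),
          mul_comm, ← div_eq_mul_inv, div_le_iff₀ (by positivity), ← Real.mul_rpow p3.le p1.le,
          mul_comm (1 + 2 * R)]
        gcongr
      calc ‖c n * h (ξ - n • w)‖ ≤ (η * (1 + |(n : ℝ)|) ^ (-σ)) * M := by
            rw [norm_mul]
            gcongr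
            · exact hc n
            · exact hhM _
        _ ≤ (η * ((1 + 2 * R) ^ σ * (1 + ‖ξ‖) ^ (-σ))) * M := by gcongr
        _ = _ := by ring
    · rw [hh, mul_zero]
      have h3 : (k - n) • w = (ξ - n • w) - (ξ - k • w) := by rw [sub_smul]; abel
      have h4 := norm_sub_le (ξ - n • w) (ξ - k • w)
      rw [← h3, hnw] at h4
      have h5 : (1 : ℝ) ≤ |((k - n : ℤ) : ℝ)| := by
        exact_mod_cast Int.one_le_abs (sub_ne_zero.2 hk)
      nlinarith
  · push Not at hex
    have : ∀ n : ℤ, c n * h (ξ - n • w) = 0 := fun n => by rw [hh _ (hex n), mul_zero]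
    simp only [this, tsum_zero, norm_zero]
    positivity

/-- Points in a ball of the chain with `n ≠ 0` have norm at least `2R - r ≥ R`, outside the support
of `h`: only the central ball sees the peak. -/
lemma ballChain_indicator_eq_zero {w : EuclideanSpace ℝ (Fin d)} {R r : ℝ} (hrR : r ≤ R)
    (hR : 0 < R) (hw : ‖w‖ = 2 * R) {h : EuclideanSpace ℝ (Fin d) → ℂ}
    (hh : ∀ ξ, R ≤ ‖ξ‖ → h ξ = 0) {ξ : EuclideanSpace ℝ (Fin d)} (hξ : ξ ∉ Metric.ball 0 r) :
    (ballChain w r).indicator h ξ = 0 := by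
  refine Set.indicator_apply_eq_zero.2 fun hmem => hh ξ ?_
  obtain ⟨n, hn⟩ := Set.mem_iUnion.1 hmem
  have hn0 : n ≠ 0 := by
    rintro rfl
    rw [zero_smul] at hn
    exact hξ hn
  rw [Metric.mem_ball, dist_comm, dist_eq_norm] at hn
  have h1 := norm_sub_norm_le (n • w) ξ
  have h2 : ‖n • w‖ = |(n : ℝ)| * (2 * R) := by
    rw [← Int.cast_smul_eq_zsmul ℝ, norm_smul, hw, Real.norm_eq_abs]
  have h3 : (1 : ℝ) ≤ |(n : ℝ)| := by exact_mod_cast Int.one_le_abs hn0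
  rw [h2] at h1
  nlinarith

/-- A function equal to `M` on a small ball and tiny off it has a weighted norm not much larger
than that of the constant on the ball. -/
lemma weightedNorm_le_of_peak {g : EuclideanSpace ℝ (Fin d) → ℂ} {α σ r M D : ℝ} {q : ℝ≥0∞}
    (hq : 1 ≤ q) (hα : 0 ≤ α) (hr : 0 < r) (hM : 0 ≤ M) (hD : 0 ≤ D)
    (h1 : ∀ᵐ ξ, ξ ∈ Metric.ball (0 : EuclideanSpace ℝ (Fin d)) r → g ξ = M)
    (h2 : ∀ᵐ ξ, ξ ∉ Metric.ball (0 : EuclideanSpace ℝ (Fin d)) r →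
      ‖g ξ‖ ≤ D * (1 + ‖ξ‖) ^ (-σ)) :
    weightedNorm α q g ≤
      ENNReal.ofReal (r ^ α * M) * volume (Metric.ball (0 : EuclideanSpace ℝ (Fin d)) r) ^
        (1 / q.toReal) +
      ENNReal.ofReal D * eLpNorm (fun ξ : EuclideanSpace ℝ (Fin d) => (1 + ‖ξ‖) ^ (-(σ - α)))
        q volume := by
  set B := Metric.ball (0 : EuclideanSpace ℝ (Fin d)) r
  set u : EuclideanSpace ℝ (Fin d) → ℝ := B.indicator fun _ => r ^ α * M
  set v : EuclideanSpace ℝ (Fin d) → ℝ := D • fun ξ => (1 + ‖ξ‖) ^ (-(σ - α))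
  have hu : AEStronglyMeasurable u volume :=
    (stronglyMeasurable_const.indicator measurableSet_ball).aestronglyMeasurable
  have hv : AEStronglyMeasurable v volume := by
    refine Continuous.aestronglyMeasurable (Continuous.const_smul ?_ D)
    exact (continuous_const.add continuous_norm).rpow_const fun x =>
      Or.inl (add_pos_of_pos_of_nonneg one_pos (norm_nonneg x)).ne'
  have hv0 (ξ) : 0 ≤ v ξ := by simp only [v, Pi.smul_apply, smul_eq_mul]; positivity
  calc weightedNorm α q g ≤ eLpNorm (u + v) q volume := by
        refine eLpNorm_mono_ae ?_
        filter_upwards [h1, h2] with ξ h1 h2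
        rw [norm_smul, Real.norm_of_nonneg (by positivity), Pi.add_apply]
        by_cases hξ : ξ ∈ B
        · have hnr : ‖ξ‖ ≤ r := by
            rw [← dist_zero_right]; exact (Metric.mem_ball.1 hξ).le
          have hu' : u ξ = r ^ α * M := Set.indicator_of_mem hξ _
          rw [h1 hξ, hu', Complex.norm_real, Real.norm_of_nonneg hM,
            Real.norm_of_nonneg (add_nonneg (by positivity) (hv0 ξ))]
          have : ‖ξ‖ ^ α * M ≤ r ^ α * M := by gcongr
          linarith [hv0 ξ]
        · have hu' : u ξ = 0 := Set.indicator_of_notMem hξ _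
          rw [hu', zero_add, Real.norm_of_nonneg (hv0 ξ)]
          have p2 : 0 < 1 + ‖ξ‖ := by positivity
          calc ‖ξ‖ ^ α * ‖g ξ‖ ≤ (1 + ‖ξ‖) ^ α * (D * (1 + ‖ξ‖) ^ (-σ)) := by
                gcongr
                · linarith
                · exact h2 hξ
            _ = v ξ := by
                simp only [v, Pi.smul_apply, smul_eq_mul]
                rw [mul_left_comm, ← Real.rpow_add p2]; congr 2; ring
    _ ≤ eLpNorm u q volume + eLpNorm v q volume := eLpNorm_add_le hu hv hq
    _ = _ := by
        -- Positive volume covers `q = ∞`, where `1 / q.toReal` is `1 / 0 = 0` and the volume factor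
        -- becomes `1`.
        have hB : volume B ≠ 0 := (Metric.measure_ball_pos volume _ hr).ne'
        rw [eLpNorm_const_smul, eLpNorm_indicator_const' measurableSet_ball hB
          (zero_lt_one.trans_le hq).ne', ← ofReal_norm, ← ofReal_norm,
          Real.norm_of_nonneg (by positivity), Real.norm_of_nonneg hD]

/-- There are a special Hadamard operator, with special Hadamard adjoint, and a function for which
the norm of the image is as large as desired whereas the two weighted norms are controlled. -/
theorem exists_isSpecialHadamard_large (hd : 0 < d) {p q : ℝ≥0∞} (hp : 1 ≤ p) (hq : 1 ≤ q)
    {α β x : ℝ} (hα : 0 < α) (hα' : α < 1 / 8) (hβ : d < β) (hx : 0 < x)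
    (hqd : ENNReal.ofReal (8 * d) < q) {K : ℝ} (hK : 0 < K) :
    ∃ (T : Lp ℂ 2 (volume : Measure (EuclideanSpace ℝ (Fin d))) →L[ℂ]
        Lp ℂ 2 (volume : Measure (EuclideanSpace ℝ (Fin d))))
      (f : Lp ℂ 2 (volume : Measure (EuclideanSpace ℝ (Fin d)))),
      IsSpecialHadamard T ∧ IsSpecialHadamard (star T) ∧ Integrable f ∧ Integrable (T f) ∧
      weightedNorm α q (T f) ≤ ENNReal.ofReal x ∧ weightedNorm β p f ≤ 1 ∧
      ENNReal.ofReal K ≤ eLpNorm (T f) q volume := by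
  have hβ0 : 0 ≤ β := (Nat.cast_nonneg d).trans hβ.le
  -- the radius of the peak
  obtain ⟨r, hr0, hr1, hrx⟩ : ∃ r : ℝ, 0 < r ∧ r ≤ 1 ∧ r ^ α * K ≤ x / 2 := by
    -- The height will be normalised so that the peak has `L^q` norm `K`. Its weighted norm is then
    -- at most `r^α K`, which is to use up half of the budget `x`.
    refine ⟨min 1 ((x / 2 / K) ^ α⁻¹), by positivity, min_le_left _ _, ?_⟩
    rw [← le_div_iff₀ hK]
    calc _ ≤ ((x / 2 / K) ^ α⁻¹) ^ α := by
          gcongr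
          exact min_le_right _ _
      _ = _ := by rw [← Real.rpow_mul (by positivity), inv_mul_cancel₀ hα.ne', Real.rpow_one]
  set B := Metric.ball (0 : EuclideanSpace ℝ (Fin d)) r
  have hB0 : volume B ≠ 0 := (Metric.measure_ball_pos volume _ hr0).ne'
  have hBt : volume B ≠ ∞ := measure_ball_lt_top.ne
  -- the height of the peak
  set V := (volume B ^ (1 / q.toReal)).toReal
  have hVt : volume B ^ (1 / q.toReal) ≠ ∞ := ENNReal.rpow_ne_top_of_nonneg (by positivity) hBt
  have hV : 0 < V := ENNReal.toReal_pos (by simp [ENNReal.rpow_eq_zero_iff, hB0, hBt]) hVt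
  have hVe : volume B ^ (1 / q.toReal) = ENNReal.ofReal V := (ENNReal.ofReal_toReal hVt).symm
  set M := K / V
  have hM : 0 < M := by positivity
  -- the scale of the function
  set C₀ := weightedNorm β p
    (𝓕⁻ (dilatedBump one_ne_zero 1) : 𝓢(EuclideanSpace ℝ (Fin d), ℂ)) with hC₀
  have hC₀t : C₀ ≠ ∞ := (weightedNorm_schwartz_lt_top hβ0 hp _).ne
  obtain ⟨ε, hε0, hε1, hεC⟩ : ∃ ε : ℝ, 0 < ε ∧ ε ≤ 1 ∧ M * ε ^ (β - d) * C₀.toReal ≤ 1 := by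
    have ht : Filter.Tendsto (fun ε : ℝ => M * ε ^ (β - d) * C₀.toReal)
        (nhdsWithin 0 (Set.Ioi 0)) (nhds 0) := by
      have : Filter.Tendsto (fun ε : ℝ => ε ^ (β - d)) (nhdsWithin 0 (Set.Ioi 0)) (nhds 0) := by
        have h0 : ContinuousAt (fun ε : ℝ => ε ^ (β - d)) 0 :=
          Real.continuousAt_rpow_const _ _ (Or.inr (by linarith))
        have := h0.tendsto
        rw [Real.zero_rpow (by linarith)] at this
        exact this.mono_left nhdsWithin_le_nhds
      simpa using (this.const_mul M).mul_const C₀.toReal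
    have e1 := ht.eventually (ge_mem_nhds (zero_lt_one))
    have e2 : ∀ᶠ ε : ℝ in nhdsWithin 0 (Set.Ioi 0), ε ∈ Set.Ioc (0 : ℝ) 1 :=
      Ioc_mem_nhdsGT zero_lt_one
    obtain ⟨ε, h1, h2⟩ := (e1.and e2).exists
    exact ⟨ε, h2.1, h2.2, h1⟩
  set h : 𝓢(EuclideanSpace ℝ (Fin d), ℂ) := dilatedBump hε0.ne' M
  set R := 2 / ε
  have hR : 0 < R := by positivity
  have hrR : r ≤ R := hr1.trans (by rw [le_div_iff₀ hε0]; linarith)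
  have hhR : ∀ ξ, R ≤ ‖ξ‖ → h ξ = 0 := by
    intro ξ hξ
    rw [dilatedBump_apply, (unitBump d).zero_of_le_dist, mul_zero, Complex.ofReal_zero]
    rw [dist_zero_right, norm_smul, Real.norm_of_nonneg hε0.le]
    rwa [div_le_iff₀' hε0] at hξ
  have hhM : ∀ ξ, ‖h ξ‖ ≤ M := by
    intro ξ
    rw [dilatedBump_apply, Complex.norm_real,
      Real.norm_of_nonneg (mul_nonneg hM.le (unitBump d).nonneg)]
    exact mul_le_of_le_one_right hM.le (unitBump d).le_one
  have hhB : ∀ ξ ∈ B, h ξ = M := by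
    intro ξ hξ
    rw [dilatedBump_apply, (unitBump d).one_of_mem_closedBall, mul_one]
    rw [Metric.mem_closedBall, dist_zero_right, norm_smul, Real.norm_of_nonneg hε0.le]
    have : ‖ξ‖ < r := by simpa [B] using hξ
    change ε * ‖ξ‖ ≤ 1
    nlinarith [norm_nonneg ξ]
  -- the modulation
  set w : EuclideanSpace ℝ (Fin d) := (2 * R) • EuclideanSpace.single ⟨0, hd⟩ 1
  have hw : ‖w‖ = 2 * R := by
    rw [norm_smul, PiLp.norm_single, norm_one, mul_one, Real.norm_of_nonneg (by positivity)]
  set S := eLpNorm (fun ξ : EuclideanSpace ℝ (Fin d) => (1 + ‖ξ‖) ^ (-(1 / 4 - α) : ℝ)) q volume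
  -- For finite `q`, `(1/4 - α) q > q/8 > d`; this is the origin of the thresholds `1/8` and `8d`.
  have hS : S ≠ ∞ := by
    refine (memLp_one_add_norm_rpow (by linarith) fun _ hqt => ?_).2.ne
    have : (8 * d : ℝ) < q.toReal := (ENNReal.ofReal_lt_iff_lt_toReal (by positivity) hqt).1 hqd
    nlinarith [(Nat.cast_pos (α := ℝ)).2 hd]
  -- The coefficients are chosen after `M`, `R` and `S`, so their smallness can beat any loss from
  -- the width of the bump; the remainder takes the other half of `x`.
  obtain ⟨η, hη, hηx⟩ : ∃ η : ℝ, 0 < η ∧ M * η * (1 + 2 * R) ^ (1 / 4 : ℝ) * S.toReal ≤ x / 2 := by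
    set D := M * (1 + 2 * R) ^ (1 / 4 : ℝ) * S.toReal
    have hD : 0 ≤ D := by positivity
    refine ⟨x / 2 / (D + 1), by positivity, ?_⟩
    calc _ = D / (D + 1) * (x / 2) := by simp only [D]; ring
      _ ≤ 1 * (x / 2) := by
        gcongr
        exact div_le_one_of_le₀ (by linarith) (by positivity)
      _ = _ := one_mul _
  obtain ⟨c, hc, hcη, hc1⟩ := exists_flat_unimodular_series hη
  have hm : Measurable (characterSum w c) := (continuous_characterSum w hc).measurable
  have hm1 := norm_characterSum w hc1
  have hA := measurableSet_ballChain w r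
  set T := hadamardOp hA hm fun x => (hm1 x).le
  set f := (𝓕⁻ h).toLp 2 (volume : Measure (EuclideanSpace ℝ (Fin d)))
  obtain ⟨hT, hT'⟩ := isSpecialHadamard_hadamardOp hA hc hm hm1 (sub_zsmul_mem_ballChain w r)
  have hae := (𝓕⁻ h).coeFn_toLp 2 (volume : Measure (EuclideanSpace ℝ (Fin d)))
  have hTf := hadamardOp_fourierInv_ae_eq hA hc hm (fun x => (hm1 x).le) h
  have hin : ∀ᵐ ξ, ξ ∈ B → T f ξ = M := by
    filter_upwards [hTf] with ξ hξ hB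
    have hmem : ξ ∈ ballChain w r := Set.mem_iUnion.2 ⟨0, by rwa [zero_smul]⟩
    rw [hξ, Set.indicator_of_mem hmem, Set.indicator_of_notMem (Set.notMem_compl_iff.2 hmem),
      add_zero, hhB ξ hB]
  have hout : ∀ᵐ ξ, ξ ∉ B →
      ‖T f ξ‖ ≤ M * η * (1 + 2 * R) ^ (1 / 4 : ℝ) * (1 + ‖ξ‖) ^ (-(1 / 4) : ℝ) := by
    filter_upwards [hTf] with ξ hξ hB
    rw [hξ, ballChain_indicator_eq_zero hrR hR hw hhR hB, zero_add]
    refine (norm_indicator_le_norm_self _ ξ).trans ?_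
    exact norm_tsum_translates_le hM.le hη.le (by norm_num) hR hw hcη hhR hhM ξ
  refine ⟨T, f, hT, hT', (𝓕⁻ h).integrable.congr hae.symm,
    integrable_hadamardOp_fourierInv hA hc hm _ h, ?_, ?_, ?_⟩
  · refine (weightedNorm_le_of_peak hq hα.le hr0 hM.le (by positivity) hin hout).trans ?_
    change _ + _ * S ≤ _
    rw [hVe, ← ENNReal.ofReal_mul (by positivity), ← ENNReal.ofReal_toReal hS,
      ← ENNReal.ofReal_mul (by positivity), ← ENNReal.ofReal_add (by positivity) (by positivity)]
    refine ENNReal.ofReal_le_ofReal ?_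
    have : r ^ α * M * V = r ^ α * K := by simp only [M]; field_simp
    linarith
  · calc weightedNorm β p f = weightedNorm β p (𝓕⁻ h : 𝓢(EuclideanSpace ℝ (Fin d), ℂ)) := by
          refine eLpNorm_congr_ae ?_
          filter_upwards [hae] with y hy
          rw [hy]
      _ ≤ ENNReal.ofReal (M * ε ^ (β - d)) * C₀ :=
          weightedNorm_fourierInv_dilatedBump_le hε0 hε1 hM.le hβ0 p
      _ ≤ 1 := by
          rw [← ENNReal.ofReal_toReal hC₀t, ← ENNReal.ofReal_mul (by positivity)]
          exact ENNReal.ofReal_le_one.2 hεC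
  · calc ENNReal.ofReal K = eLpNorm (B.indicator fun _ => (M : ℂ)) q volume := by
          rw [eLpNorm_indicator_const' measurableSet_ball hB0 (zero_lt_one.trans_le hq).ne', hVe,
            ← ofReal_norm, Complex.norm_real, Real.norm_of_nonneg hM.le,
            ← ENNReal.ofReal_mul hM.le]
          congr 1
          simp only [M]; field_simp
      _ ≤ eLpNorm (T f) q volume := by
          refine eLpNorm_mono_ae ?_
          filter_upwards [hin] with ξ hξ
          by_cases hB : ξ ∈ B
          · rw [Set.indicator_of_mem hB, hξ hB]
          · rw [Set.indicator_of_notMem hB, norm_zero]; exact norm_nonneg _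

theorem hadamardSup_eq_top (hd : 0 < d) {p q : ℝ≥0∞} (hp : 1 ≤ p) (hq : 1 ≤ q)
    {α β x : ℝ} (hα : 0 < α) (hα' : α < 1 / 8) (hβ : d < β) (hx : 0 < x)
    (hqd : ENNReal.ofReal (8 * d) < q) : hadamardSup d p q α β x = ∞ := by
  refine ENNReal.eq_top_of_forall_nnreal_le fun K => ?_
  obtain ⟨T, f, hT, -, hf, -, h1, h2, h3⟩ :=
    exists_isSpecialHadamard_large hd hp hq hα hα' hβ hx hqd (K := K + 1) (by positivity)
  calc (K : ℝ≥0∞) ≤ ENNReal.ofReal (K + 1) := by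
        rw [← ENNReal.ofReal_coe_nnreal]; exact ENNReal.ofReal_le_ofReal (by linarith)
    _ ≤ eLpNorm (T f) q volume := h3
    _ ≤ _ := le_iSup_of_le T <| le_iSup_of_le hT <| le_iSup_of_le f <| le_iSup_of_le hf <|
      le_iSup_of_le h1 <| le_iSup_of_le h2 (le_refl (eLpNorm (T f) q volume))

/-- The same example read backwards: the operator is `T*`, the function is `Tf`, and `T* T f = f`
carries the bound in the weight `β`. -/
theorem hadamardSup'_eq_top (hd : 0 < d) {p q : ℝ≥0∞} (hp : 1 ≤ p) (hq : 1 ≤ q)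
    {α β x : ℝ} (hα : 0 < α) (hα' : α < 1 / 8) (hβ : d < β) (hx : 0 < x)
    (hqd : ENNReal.ofReal (8 * d) < q) : hadamardSup' d p q α β x = ∞ := by
  refine ENNReal.eq_top_of_forall_nnreal_le fun K => ?_
  obtain ⟨T, f, hT, hT', -, hTf, h1, h2, h3⟩ :=
    exists_isSpecialHadamard_large hd hp hq hα hα' hβ hx hqd (K := K + 1) (by positivity)
  have hfT : star T (T f) = f := congrArg (fun S => S f) hT.adjoint_comp
  have h2' : weightedNorm β p (star T (T f)) ≤ 1 := by rwa [hfT]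
  calc (K : ℝ≥0∞) ≤ ENNReal.ofReal (K + 1) := by
        rw [← ENNReal.ofReal_coe_nnreal]; exact ENNReal.ofReal_le_ofReal (by linarith)
    _ ≤ eLpNorm (T f) q volume := h3
    _ ≤ _ := le_iSup_of_le (star T) <| le_iSup_of_le hT' <| le_iSup_of_le (T f) <|
      le_iSup_of_le hTf <| le_iSup_of_le h1 <| le_iSup_of_le h2' (le_refl (eLpNorm (T f) q volume))

end BlowUp

/-! ### Finiteness for the Fourier transform -/

section Boundedness

variable {d : ℕ}

open scoped SchwartzMap

lemma lintegral_enorm_mul_enorm_le {α : Type*} [MeasurableSpace α] {μ : Measure α} {p p' : ℝ≥0∞}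
    (h : p'.HolderConjugate p) {u : α → ℝ} {v : α → ℂ} (hu : AEStronglyMeasurable u μ)
    (hv : AEStronglyMeasurable v μ) :
    ∫⁻ x, ‖u x‖ₑ * ‖v x‖ₑ ∂μ ≤ eLpNorm u p' μ * eLpNorm v p μ := by
  have := eLpNorm_smul_le_mul_eLpNorm (r := 1) (hpqr := h) hv hu
  rw [eLpNorm_one_eq_lintegral_enorm] at this
  simpa only [Pi.smul_apply', enorm_smul] using this

/-- A locally integrable function which acts on test functions as a bounded function is bounded. -/
lemma ae_enorm_le_of_integral_mul_schwartz_le {f : EuclideanSpace ℝ (Fin d) → ℂ}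
    (hf : LocallyIntegrable f) {C : ℝ≥0∞}
    (h : ∀ ψ : 𝓢(EuclideanSpace ℝ (Fin d), ℂ), ‖∫ x, f x * ψ x‖ₑ ≤ C * ∫⁻ x, ‖ψ x‖ₑ) :
    ∀ᵐ x, ‖f x‖ₑ ≤ C := by
  let φ : ℕ → ContDiffBump (0 : EuclideanSpace ℝ (Fin d)) := fun i =>
    { rIn := 1 / ((i : ℝ) + 1)
      rOut := 2 * (1 / ((i : ℝ) + 1))
      rIn_pos := by positivity
      rIn_lt_rOut := by
        have : 0 < 1 / ((i : ℝ) + 1) := by positivity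
        linarith }
  have ht : Filter.Tendsto (fun i => (φ i).rOut) Filter.atTop (nhds 0) := by
    have := (tendsto_one_div_add_atTop_nhds_zero_nat (𝕜 := ℝ)).const_mul 2
    rwa [mul_zero] at this
  filter_upwards [ContDiffBump.ae_convolution_tendsto_right_of_locallyIntegrable (K := 2)
    (μ := volume) ht (Filter.Eventually.of_forall fun i => le_rfl) hf] with x hx
  refine le_of_tendsto hx.enorm (Filter.Eventually.of_forall fun i => ?_)
  -- Mollification at `x` is a pairing with a test function of `L¹` norm one, so it is bounded by
  -- `C`, and it converges to `f x` at almost every `x`.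
  set ρ : EuclideanSpace ℝ (Fin d) → ℝ := fun y => (φ i).normed volume (x - y)
  have hρ : HasCompactSupport ρ :=
    (φ i).hasCompactSupport_normed.comp_homeomorph (Homeomorph.subLeft x)
  have hρs : ContDiff ℝ (⊤ : ℕ∞) ρ := (φ i).contDiff_normed.comp (contDiff_const.sub contDiff_id)
  have hρ' : HasCompactSupport (fun y => (ρ y : ℂ)) := hρ.comp_left (g := Complex.ofReal) rfl
  have hρs' : ContDiff ℝ (⊤ : ℕ∞) (fun y => (ρ y : ℂ)) := Complex.ofRealCLM.contDiff.comp hρs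
  have hi := h (hρ'.toSchwartzMap hρs')
  have h1 : ∫⁻ y, ‖(hρ'.toSchwartzMap hρs') y‖ₑ = 1 := by
    have hn : ∀ y, 0 ≤ ρ y := fun y => (φ i).nonneg_normed _
    have h2 : ∫ y, ρ y = 1 := by
      rw [integral_sub_left_eq_self (fun y => (φ i).normed volume y)]
      exact (φ i).integral_normed
    have h3 : Integrable ρ := hρs.continuous.integrable_of_hasCompactSupport hρ
    rw [← ofReal_integral_norm_eq_lintegral_enorm (SchwartzMap.integrable _)]
    simp only [HasCompactSupport.toSchwartzMap_toFun, Complex.norm_real]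
    rw [integral_congr_ae (ae_of_all _ fun y => Real.norm_of_nonneg (hn y)), h2, ENNReal.ofReal_one]
  rw [h1, mul_one] at hi
  rw [convolution_eq_swap]
  convert! hi using 3
  funext y
  simp [ρ, mul_comm]

/-- The cutoff kills the unit ball, and outside it `‖ξ‖^(-β) ≤ 2^β (1 + ‖ξ‖)^(-β)`, which lies in
`L^p` for all `p ≥ 1` because `β > d`. -/
lemma eLpNorm_one_sub_bump_mul_rpow_lt_top {β : ℝ} (hβ : d < β) {p : ℝ≥0∞} (hp : 1 ≤ p) :
    eLpNorm (fun ξ : EuclideanSpace ℝ (Fin d) => (1 - unitBump d ξ) * ‖ξ‖ ^ (-β)) p volume < ∞ := by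
  have hβ0 : 0 ≤ β := (Nat.cast_nonneg d).trans hβ.le
  have hm := (memLp_one_add_norm_rpow (d := d) (p := p) hβ0 (fun _ hpt => by
    have : (1 : ℝ) ≤ p.toReal := by
      rw [← ENNReal.toReal_one]; exact ENNReal.toReal_mono hpt hp
    nlinarith)).const_mul (2 ^ β)
  refine lt_of_le_of_lt (eLpNorm_mono fun ξ => ?_) hm.2
  have h0 : 0 ≤ 1 - unitBump d ξ := sub_nonneg.2 (unitBump d).le_one
  have p1 : 0 < 1 + ‖ξ‖ := by positivity
  rw [Real.norm_of_nonneg (by positivity), Real.norm_of_nonneg (by positivity)]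
  rcases le_total ‖ξ‖ 1 with h | h
  · rw [(unitBump d).one_of_mem_closedBall (show ξ ∈ Metric.closedBall 0 1 by simpa using h), sub_self, zero_mul]
    positivity
  · have p2 : 0 < ‖ξ‖ := by linarith
    calc _ ≤ 1 * ‖ξ‖ ^ (-β) := by
          gcongr
          linarith [(unitBump d).nonneg (x := ξ)]
      _ ≤ 2 ^ β * (1 + ‖ξ‖) ^ (-β) := by
          rw [one_mul, Real.rpow_neg p2.le, Real.rpow_neg p1.le, ← div_eq_mul_inv,
            le_div_iff₀ (by positivity), mul_comm, ← div_eq_mul_inv, div_le_iff₀ (by positivity),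
            ← Real.mul_rpow (by norm_num) p2.le]
          gcongr
          linarith

/-- The high frequencies of a function with finite weighted norm are integrable. -/
lemma lintegral_one_sub_bump_mul_le {β : ℝ} {p p' : ℝ≥0∞}
    (hpp : p'.HolderConjugate p) {g : EuclideanSpace ℝ (Fin d) → ℂ}
    (hg : AEStronglyMeasurable g volume) :
    ∫⁻ ξ, ‖((1 - unitBump d ξ : ℝ) : ℂ) * g ξ‖ₑ ≤
      eLpNorm (fun ξ : EuclideanSpace ℝ (Fin d) => (1 - unitBump d ξ) * ‖ξ‖ ^ (-β)) p' volume *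
        weightedNorm β p g := by
  have hw : Measurable fun ξ : EuclideanSpace ℝ (Fin d) => ‖ξ‖ ^ (-β) := by fun_prop
  have hw' : Measurable fun ξ : EuclideanSpace ℝ (Fin d) => ‖ξ‖ ^ β := by fun_prop
  have hb : Measurable fun ξ : EuclideanSpace ℝ (Fin d) => 1 - unitBump d ξ :=
    (continuous_const.sub (unitBump d).continuous).measurable
  refine le_trans (lintegral_mono fun ξ => ?_) (lintegral_enorm_mul_enorm_le hpp
    (hb.mul hw).aestronglyMeasurable (hw'.aestronglyMeasurable.smul hg))
  rw [← enorm_smul, smul_smul]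
  -- At the origin the two powers of `‖ξ‖` need not cancel, but there `1 - unitBump` vanishes.
  by_cases hξ : ξ = 0
  · rw [hξ, (unitBump d).one_of_mem_closedBall (by simp [(unitBump d).rIn_pos.le])]
    simp
  · rw [mul_assoc, ← Real.rpow_add (norm_pos_iff.2 hξ), neg_add_cancel, Real.rpow_zero, mul_one,
      Complex.real_smul]

lemma eLpNorm_indicator_ball_rpow_lt_top (hd : 0 < d) {α : ℝ} {p : ℝ≥0∞}
    (hp : 1 ≤ p) (hpt : p ≠ ∞) (h : α * p.toReal < d) :
    eLpNorm ((Metric.ball (0 : EuclideanSpace ℝ (Fin d)) 1).indicator fun y => ‖y‖ ^ (-α))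
      p volume < ∞ := by
  have hw : Measurable fun ξ : EuclideanSpace ℝ (Fin d) => ‖ξ‖ ^ (-α) := by fun_prop
  have hw' : Measurable fun ξ : EuclideanSpace ℝ (Fin d) => ‖ξ‖ ^ (-(α * p.toReal)) := by fun_prop
  rw [eLpNorm_indicator_eq_eLpNorm_restrict measurableSet_ball]
  refine MemLp.eLpNorm_lt_top ?_
  rw [← integrable_norm_rpow_iff hw.aestronglyMeasurable (zero_lt_one.trans_le hp).ne' hpt]
  have := integrableOn_ball_of_norm_le_rpow (μ := (volume : Measure (EuclideanSpace ℝ (Fin d))))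
    (by rw [finrank_euclideanSpace_fin]; exact hd) (C := 1) (α := α * p.toReal) (r := 1)
    (by rw [finrank_euclideanSpace_fin]; exact h)
    (ae_of_all _ fun x => by rw [one_mul, Real.norm_of_nonneg (by positivity)])
    hw'.aestronglyMeasurable
  refine this.congr (ae_of_all _ fun x => ?_)
  simp only
  rw [Real.norm_of_nonneg (by positivity), ← Real.rpow_mul (norm_nonneg x), neg_mul]

/-- Translates of a Schwartz function pair boundedly with a function of finite weighted norm. -/
lemma lintegral_mul_translate_le (hd : 0 < d) {α : ℝ} {q q' : ℝ≥0∞} (hq' : 1 ≤ q')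
    (hqq : q'.HolderConjugate q) {f : EuclideanSpace ℝ (Fin d) → ℂ}
    (hf : AEStronglyMeasurable f volume) (φ : 𝓢(EuclideanSpace ℝ (Fin d), ℂ)) {C : ℝ} (hα : 0 < α)
    (hC : ∀ x, ‖φ x‖ ≤ C) (z : EuclideanSpace ℝ (Fin d)) :
    ∫⁻ y, ‖f y‖ₑ * ‖φ (z - y)‖ₑ ≤
      (ENNReal.ofReal C * eLpNorm ((Metric.ball (0 : EuclideanSpace ℝ (Fin d)) 1).indicator
        fun y => ‖y‖ ^ (-α)) q' volume + eLpNorm φ q' volume) * weightedNorm α q f := by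
  have : Nontrivial (EuclideanSpace ℝ (Fin d)) :=
    Module.nontrivial_of_finrank_pos (R := ℝ) (by rwa [finrank_euclideanSpace_fin])
  set u : EuclideanSpace ℝ (Fin d) → ℝ := fun y => ‖y‖ ^ (-α) * ‖φ (z - y)‖
  set a := (Metric.ball (0 : EuclideanSpace ℝ (Fin d)) 1).indicator fun y => ‖y‖ ^ (-α)
  have hC0 : 0 ≤ C := (norm_nonneg _).trans (hC 0)
  have hw : Measurable fun ξ : EuclideanSpace ℝ (Fin d) => ‖ξ‖ ^ (-α) := by fun_prop
  have hw' : Measurable fun ξ : EuclideanSpace ℝ (Fin d) => ‖ξ‖ ^ α := by fun_prop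
  have hφ : Continuous fun y => ‖φ (z - y)‖ :=
    (φ.continuous.comp (continuous_const.sub continuous_id)).norm
  have ha : AEStronglyMeasurable a volume :=
    (hw.indicator measurableSet_ball).aestronglyMeasurable
  calc ∫⁻ y, ‖f y‖ₑ * ‖φ (z - y)‖ₑ ≤ ∫⁻ y, ‖u y‖ₑ * ‖(‖y‖ ^ α) • f y‖ₑ := by
        refine lintegral_mono_ae ?_
        filter_upwards [Measure.ae_ne volume (0 : EuclideanSpace ℝ (Fin d))] with y hy
        have : u y • (‖y‖ ^ α) • f y = ‖φ (z - y)‖ • f y := by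
          rw [smul_smul, mul_right_comm, ← Real.rpow_add (norm_pos_iff.2 hy),
            neg_add_cancel, Real.rpow_zero, one_mul]
        rw [← enorm_smul (u y), this, enorm_smul, enorm_norm, mul_comm]
    _ ≤ eLpNorm u q' volume * weightedNorm α q f :=
        lintegral_enorm_mul_enorm_le hqq (hw.mul hφ.measurable).aestronglyMeasurable
          (hw'.aestronglyMeasurable.smul hf)
    _ ≤ _ := by
        gcongr
        -- Near the origin bound `φ` by `C`, away from it bound the weight by `1`. The norm of the
        -- remaining translate of `φ` does not depend on `z`, which makes the estimate uniform.
        calc eLpNorm u q' volume ≤ eLpNorm (C • a + fun y => ‖φ (z - y)‖) q' volume := by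
              refine eLpNorm_mono fun y => ?_
              have ha0 : 0 ≤ a y := Set.indicator_nonneg (fun _ _ => by positivity) y
              simp only [u, Pi.add_apply, Pi.smul_apply, smul_eq_mul]
              rw [Real.norm_of_nonneg (by positivity), Real.norm_of_nonneg (by positivity)]
              by_cases hy : y ∈ Metric.ball (0 : EuclideanSpace ℝ (Fin d)) 1
              · have : a y = ‖y‖ ^ (-α) := Set.indicator_of_mem hy _
                rw [this, mul_comm C]
                have : ‖y‖ ^ (-α) * ‖φ (z - y)‖ ≤ ‖y‖ ^ (-α) * C := by
                  gcongr; exact hC _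
                linarith [norm_nonneg (φ (z - y))]
              · have h1 : 1 ≤ ‖y‖ := by simpa using hy
                have : ‖y‖ ^ (-α) * ‖φ (z - y)‖ ≤ 1 * ‖φ (z - y)‖ := by
                  gcongr
                  exact Real.rpow_le_one_of_one_le_of_nonpos h1 (by linarith)
                have : 0 ≤ C * a y := by positivity
                linarith
          _ ≤ eLpNorm (C • a) q' volume + eLpNorm (fun y => ‖φ (z - y)‖) q' volume :=
              eLpNorm_add_le (ha.const_smul C) hφ.aestronglyMeasurable hq'
          _ = _ := by
              have h2 := eLpNorm_comp_measurePreserving (p := q') (g := φ)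
                φ.continuous.aestronglyMeasurable
                (Measure.measurePreserving_sub_left (volume : Measure (EuclideanSpace ℝ (Fin d))) z)
              rw [eLpNorm_const_smul, eLpNorm_norm, ← ofReal_norm, Real.norm_of_nonneg hC0]
              congr 1

lemma integrable_Lp_mul_schwartz (f : Lp ℂ 2 (volume : Measure (EuclideanSpace ℝ (Fin d))))
    (ψ : 𝓢(EuclideanSpace ℝ (Fin d), ℂ)) : Integrable fun x => f x * ψ x :=
  (Lp.memLp f).integrable_mul (ψ.memLp 2 volume)

lemma integrable_fourier_mul_schwartz {f : EuclideanSpace ℝ (Fin d) → ℂ} (hf : Integrable f)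
    (ψ : 𝓢(EuclideanSpace ℝ (Fin d), ℂ)) : Integrable fun x => 𝓕 f x * ψ x := by
  refine ψ.integrable.bdd_mul (c := ∫ y, ‖f y‖) (Continuous.aestronglyMeasurable ?_)
    (ae_of_all _ (norm_fourier_le f))
  exact VectorFourier.fourierIntegral_continuous Real.continuous_fourierChar continuous_inner hf

lemma IsFourierTransform.integrable_right_mul {f g : EuclideanSpace ℝ (Fin d) → ℂ}
    (h : IsFourierTransform f g) (ψ : 𝓢(EuclideanSpace ℝ (Fin d), ℂ)) :
    Integrable fun x => g x * ψ x := by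
  obtain ⟨f₁, f₂, hf₁, hf, hg⟩ := h
  refine ((integrable_fourier_mul_schwartz hf₁ ψ).add
    (integrable_Lp_mul_schwartz (𝓕 f₂) ψ)).congr ?_
  filter_upwards [hg] with x hx
  rw [hx, add_mul]; rfl

/-- The multiplication formula on `L¹ + L²`. -/
lemma IsFourierTransform.integral_mul {f g : EuclideanSpace ℝ (Fin d) → ℂ}
    (h : IsFourierTransform f g) (ψ : 𝓢(EuclideanSpace ℝ (Fin d), ℂ)) :
    ∫ ξ, g ξ * ψ ξ = ∫ x, f x * 𝓕 ψ x := by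
  obtain ⟨f₁, f₂, hf₁, hf, hg⟩ := h
  obtain ⟨C, hC0, hC⟩ := exists_norm_schwartz_le (𝓕 ψ) 0
  have h1 : Integrable fun x => f₁ x * 𝓕 ψ x :=
    hf₁.mul_bdd (c := C) (𝓕 ψ).continuous.aestronglyMeasurable
      (ae_of_all _ fun x => by simpa using hC x)
  calc ∫ ξ, g ξ * ψ ξ = ∫ ξ, (𝓕 f₁ ξ * ψ ξ + (𝓕 f₂ : Lp ℂ 2 volume) ξ * ψ ξ) := by
        refine integral_congr_ae ?_
        filter_upwards [hg] with x hx
        rw [hx, add_mul]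
    _ = ∫ x, (f₁ x * 𝓕 ψ x + f₂ x * 𝓕 ψ x) := by
        rw [integral_add (integrable_fourier_mul_schwartz hf₁ ψ)
          (integrable_Lp_mul_schwartz (𝓕 f₂) ψ),
          integral_add h1 (integrable_Lp_mul_schwartz f₂ (𝓕 ψ)),
          integral_fourier_mul_schwartz hf₁, integral_fourier_Lp_mul_schwartz]
    _ = _ := by
        refine integral_congr_ae ?_
        filter_upwards [hf] with x hx
        rw [hx, add_mul]

lemma IsFourierTransform.locallyIntegrable_left {f g : EuclideanSpace ℝ (Fin d) → ℂ}
    (h : IsFourierTransform f g) : LocallyIntegrable f := by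
  obtain ⟨f₁, f₂, hf₁, hf, hg⟩ := h
  exact (hf₁.locallyIntegrable.add ((Lp.memLp f₂).locallyIntegrable (by norm_num))).congr
    (by filter_upwards [hf] with x hx using hx.symm)

lemma IsFourierTransform.aestronglyMeasurable_right {f g : EuclideanSpace ℝ (Fin d) → ℂ}
    (h : IsFourierTransform f g) : AEStronglyMeasurable g volume := by
  obtain ⟨f₁, f₂, hf₁, hf, hg⟩ := h
  have hc : Continuous (𝓕 f₁) :=
    VectorFourier.fourierIntegral_continuous Real.continuous_fourierChar continuous_inner hf₁
  exact (hc.aestronglyMeasurable.add (Lp.aestronglyMeasurable (𝓕 f₂))).congr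
    (by filter_upwards [hg] with x hx using hx.symm)

/-- `𝓕 (η 𝓕⁻ ψ)` is the convolution of `ψ` with a reflection of `𝓕⁻ η`. -/
lemma fourier_mul_fourierInv_schwartz (η ψ : 𝓢(EuclideanSpace ℝ (Fin d), ℂ))
    (y : EuclideanSpace ℝ (Fin d)) :
    𝓕 (fun ξ => η ξ * 𝓕⁻ ψ ξ) y = ∫ z, 𝓕⁻ η (z - y) * ψ z := by
  have hi : Integrable fun ξ => character (-y) ξ * η ξ :=
    η.integrable.bdd_mul (c := 1) (continuous_character _).aestronglyMeasurable
      (ae_of_all _ fun ξ => (norm_character _ ξ).le)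
  have h1 := integral_fourierInv_mul_schwartz hi ψ
  have h2 (z : EuclideanSpace ℝ (Fin d)) :
      𝓕⁻ (fun ξ => character (-y) ξ * η ξ) z = 𝓕⁻ η (z - y) := by
    rw [SchwartzMap.fourierInv_coe, Real.fourierInv_eq_fourier_neg, fourier_character_mul,
      Real.fourierInv_eq_fourier_neg, neg_sub_neg, neg_sub]
  simp only [h2] at h1
  rw [h1, Real.fourier_eq']
  refine integral_congr_ae (ae_of_all _ fun ξ => ?_)
  simp only [smul_eq_mul, character, ← mul_assoc]
  congr 3
  rw [inner_neg_left, real_inner_comm]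
  push_cast; ring

/-- Boundedness of a function with high frequencies in `L¹` and bounded averages. -/
lemma IsFourierTransform.ae_enorm_le {f g : EuclideanSpace ℝ (Fin d) → ℂ}
    (h : IsFourierTransform f g) {C₁ C₂ : ℝ≥0∞} (η : 𝓢(EuclideanSpace ℝ (Fin d), ℂ))
    (h1 : ∫⁻ ξ, ‖(1 - η ξ) * g ξ‖ₑ ≤ C₁)
    (h2 : ∀ z, ∫⁻ y, ‖f y‖ₑ * ‖𝓕⁻ η (z - y)‖ₑ ≤ C₂) :
    ∀ᵐ x, ‖f x‖ₑ ≤ C₁ + C₂ := by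
  refine ae_enorm_le_of_integral_mul_schwartz_le h.locallyIntegrable_left fun ψ => ?_
  set χ := 𝓕⁻ ψ
  set κ := SchwartzMap.pairing (ContinuousLinearMap.mul ℂ ℂ) η χ
  have hκ (ξ) : κ ξ = η ξ * χ ξ := rfl
  have hψ : 𝓕 χ = ψ := FourierTransform.fourier_fourierInv_eq ψ
  -- Writing `ψ = 𝓕 χ` moves the pairing to the frequency side. The low-frequency part is moved
  -- back: there `𝓕 (η χ)` is a convolution involving `ψ`, and Tonelli brings in the averages of
  -- `|f|`.
  have hsplit : ∫ x, f x * ψ x = (∫ ξ, (1 - η ξ) * g ξ * χ ξ) + ∫ x, f x * 𝓕 κ x := by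
    rw [← hψ, ← h.integral_mul, ← h.integral_mul, ← integral_add]
    · refine integral_congr_ae (ae_of_all _ fun ξ => ?_)
      simp only [hκ]; ring
    · refine ((h.integrable_right_mul χ).sub (h.integrable_right_mul κ)).congr
        (ae_of_all _ fun ξ => ?_)
      simp only [Pi.sub_apply, hκ]; ring
    · exact h.integrable_right_mul κ
  rw [hsplit, add_mul]
  refine (enorm_add_le _ _).trans (add_le_add ?_ ?_)
  · have hχ (ξ) : ‖χ ξ‖ₑ ≤ ∫⁻ x, ‖ψ x‖ₑ := by
      rw [← ofReal_integral_norm_eq_lintegral_enorm ψ.integrable, ← ofReal_norm]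
      refine ENNReal.ofReal_le_ofReal ?_
      simp only [χ]
      rw [SchwartzMap.fourierInv_coe]
      exact norm_fourierInv_le _ _
    calc _ ≤ ∫⁻ ξ, ‖(1 - η ξ) * g ξ * χ ξ‖ₑ := enorm_integral_le_lintegral_enorm _
      _ ≤ ∫⁻ ξ, ‖(1 - η ξ) * g ξ‖ₑ * ∫⁻ x, ‖ψ x‖ₑ := by
          refine lintegral_mono fun ξ => ?_
          rw [enorm_mul]
          gcongr
          exact hχ ξ
      _ = (∫⁻ ξ, ‖(1 - η ξ) * g ξ‖ₑ) * ∫⁻ x, ‖ψ x‖ₑ :=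
          lintegral_mul_const' _ _ ψ.integrable.2.ne
      _ ≤ _ := by gcongr
  · have hm : AEMeasurable (fun y => ‖f y‖ₑ) volume :=
      h.locallyIntegrable_left.aestronglyMeasurable.enorm
    have hφ : Measurable fun p : EuclideanSpace ℝ (Fin d) × EuclideanSpace ℝ (Fin d) =>
        ‖𝓕⁻ η (p.2 - p.1)‖ₑ * ‖ψ p.2‖ₑ := by
      have m1 : Measurable fun p : EuclideanSpace ℝ (Fin d) × EuclideanSpace ℝ (Fin d) =>
          ‖𝓕⁻ η (p.2 - p.1)‖ₑ :=
        ((𝓕⁻ η).continuous.comp (continuous_snd.sub continuous_fst)).enorm.measurable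
      have m2 : Measurable fun p : EuclideanSpace ℝ (Fin d) × EuclideanSpace ℝ (Fin d) =>
          ‖ψ p.2‖ₑ := (ψ.continuous.comp continuous_snd).enorm.measurable
      exact m1.mul m2
    calc _ ≤ ∫⁻ y, ‖f y * 𝓕 κ y‖ₑ := enorm_integral_le_lintegral_enorm _
      _ ≤ ∫⁻ y, ∫⁻ z, ‖f y‖ₑ * (‖𝓕⁻ η (z - y)‖ₑ * ‖ψ z‖ₑ) := by
          refine lintegral_mono fun y => ?_
          rw [enorm_mul, lintegral_const_mul' _ _ enorm_ne_top]
          gcongr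
          have : 𝓕 κ y = ∫ z, 𝓕⁻ η (z - y) * ψ z := fourier_mul_fourierInv_schwartz η ψ y
          rw [this]
          refine (enorm_integral_le_lintegral_enorm _).trans (le_of_eq ?_)
          simp only [enorm_mul]
      _ = ∫⁻ z, ∫⁻ y, ‖f y‖ₑ * (‖𝓕⁻ η (z - y)‖ₑ * ‖ψ z‖ₑ) := by
          refine lintegral_lintegral_swap ?_
          exact (hm.comp_fst).mul hφ.aemeasurable
      _ = ∫⁻ z, (∫⁻ y, ‖f y‖ₑ * ‖𝓕⁻ η (z - y)‖ₑ) * ‖ψ z‖ₑ := by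
          refine lintegral_congr fun z => ?_
          rw [← lintegral_mul_const' _ _ enorm_ne_top]
          simp only [mul_assoc]
      _ ≤ ∫⁻ z, C₂ * ‖ψ z‖ₑ := by
          refine lintegral_mono fun z => ?_
          gcongr
          exact h2 z
      _ = _ := lintegral_const_mul _ ψ.continuous.enorm.measurable

/-- On the unit ball the sup bound is used; off it the weight `‖x‖^α` is at least one. -/
lemma eLpNorm_le_of_ae_enorm_le {f : EuclideanSpace ℝ (Fin d) → ℂ}
    (hf : AEStronglyMeasurable f volume) {α : ℝ} (hα : 0 ≤ α) {q : ℝ≥0∞} (hq : 1 ≤ q) {C : ℝ≥0∞}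
    (hC : C ≠ ∞) (h : ∀ᵐ x, ‖f x‖ₑ ≤ C) :
    eLpNorm f q volume ≤
      C * volume (Metric.ball (0 : EuclideanSpace ℝ (Fin d)) 1) ^ (1 / q.toReal) +
        weightedNorm α q f := by
  set u : EuclideanSpace ℝ (Fin d) → ℝ :=
    (Metric.ball (0 : EuclideanSpace ℝ (Fin d)) 1).indicator fun _ => C.toReal
  have hu : AEStronglyMeasurable u volume :=
    (stronglyMeasurable_const.indicator measurableSet_ball).aestronglyMeasurable
  have hw' : Measurable fun ξ : EuclideanSpace ℝ (Fin d) => ‖ξ‖ ^ α := by fun_prop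
  have hv : AEStronglyMeasurable (fun x => ‖(‖x‖ ^ α) • f x‖) volume :=
    (hw'.aestronglyMeasurable.smul hf).norm
  calc eLpNorm f q volume ≤ eLpNorm (u + fun x => ‖(‖x‖ ^ α) • f x‖) q volume := by
        refine eLpNorm_mono_ae ?_
        filter_upwards [h] with x hx
        have hx' : ‖f x‖ ≤ C.toReal := by
          rw [← toReal_enorm]; exact ENNReal.toReal_mono hC hx
        have hu0 : 0 ≤ u x := Set.indicator_nonneg (fun _ _ => ENNReal.toReal_nonneg) x
        rw [Pi.add_apply, Real.norm_of_nonneg (by positivity)]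
        by_cases hb : x ∈ Metric.ball (0 : EuclideanSpace ℝ (Fin d)) 1
        · have : u x = C.toReal := Set.indicator_of_mem hb _
          rw [this]
          linarith [norm_nonneg ((‖x‖ ^ α) • f x)]
        · have h1 : 1 ≤ ‖x‖ := by simpa using hb
          have : ‖f x‖ ≤ ‖(‖x‖ ^ α) • f x‖ := by
            rw [norm_smul, Real.norm_of_nonneg (by positivity)]
            exact le_mul_of_one_le_left (norm_nonneg _) (Real.one_le_rpow h1 hα)
          linarith
    _ ≤ eLpNorm u q volume + eLpNorm (fun x => ‖(‖x‖ ^ α) • f x‖) q volume :=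
        eLpNorm_add_le hu hv hq
    _ = _ := by
        rw [eLpNorm_norm, eLpNorm_indicator_const' measurableSet_ball
          (Metric.measure_ball_pos volume _ one_pos).ne' (zero_lt_one.trans_le hq).ne',
          ← ofReal_norm, Real.norm_of_nonneg ENNReal.toReal_nonneg, ENNReal.ofReal_toReal hC]
        rfl

theorem fourierH_lt_top (hd : 0 < d) {p q : ℝ≥0∞} (hp : 1 ≤ p) (hq : 1 ≤ q)
    {α β x : ℝ} (hα : 0 < α) (hα' : α < 1 / 8) (hβ : d < β)
    (hqd : ENNReal.ofReal (8 * d) < q) : fourierH d p q α β x < ∞ := by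
  have hd1 : (1 : ℝ) ≤ d := by exact_mod_cast hd
  set p' := p.conjExponent
  set q' := q.conjExponent
  have hpp : p'.HolderConjugate p := (ENNReal.HolderConjugate.conjExponent hp).symm
  have hqq : q'.HolderConjugate q := (ENNReal.HolderConjugate.conjExponent hq).symm
  have hp' : 1 ≤ p' := le_self_add
  have hq' : 1 ≤ q' := le_self_add
  -- Since `q > 8d ≥ 8`, the conjugate exponent is at most `2`, and `α q' ≤ 2α < 1 ≤ d` gives the
  -- local integrability needed at the origin.
  have hq2 : 2 ≤ q := by
    refine le_trans ?_ hqd.le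
    rw [← ENNReal.ofReal_ofNat]
    exact ENNReal.ofReal_le_ofReal (by linarith)
  have hq'2 : q' ≤ 2 := by
    have : (1 : ℝ≥0∞) ≤ q - 1 := by
      have h3 : (1 : ℝ≥0∞) + 1 ≤ q := by rwa [one_add_one_eq_two]
      exact ENNReal.le_sub_of_add_le_left ENNReal.one_ne_top h3
    calc q' = 1 + (q - 1)⁻¹ := rfl
      _ ≤ 1 + 1 := by gcongr; exact ENNReal.inv_le_one.2 this
      _ = 2 := one_add_one_eq_two
  have hq't : q' ≠ ∞ := (hq'2.trans_lt (by norm_num)).ne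
  have hαq : α * q'.toReal < d := by
    have : q'.toReal ≤ 2 := by
      simpa using ENNReal.toReal_mono (by norm_num) hq'2
    nlinarith [ENNReal.toReal_nonneg (a := q')]
  set η : 𝓢(EuclideanSpace ℝ (Fin d), ℂ) := dilatedBump one_ne_zero 1
  have hη (ξ : EuclideanSpace ℝ (Fin d)) : 1 - η ξ = ((1 - unitBump d ξ : ℝ) : ℂ) := by
    simp only [η, dilatedBump_apply, one_smul, one_mul]; push_cast; rfl
  let θ : 𝓢(EuclideanSpace ℝ (Fin d), ℂ) := 𝓕⁻ η
  obtain ⟨C, hC0, hC⟩ := exists_norm_schwartz_le θ 0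
  have hC' (x) : ‖θ x‖ ≤ C := by simpa using hC x
  set C₁ := eLpNorm (fun ξ : EuclideanSpace ℝ (Fin d) => (1 - unitBump d ξ) * ‖ξ‖ ^ (-β)) p' volume
  have hC₁ : C₁ < ∞ := eLpNorm_one_sub_bump_mul_rpow_lt_top hβ hp'
  set C₂ := (ENNReal.ofReal C * eLpNorm ((Metric.ball (0 : EuclideanSpace ℝ (Fin d)) 1).indicator
        fun y => ‖y‖ ^ (-α)) q' volume + eLpNorm θ q' volume) * ENNReal.ofReal x
  have hC₂ : C₂ < ∞ :=
    ENNReal.mul_lt_top (ENNReal.add_lt_top.2 ⟨ENNReal.mul_lt_top ENNReal.ofReal_lt_top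
      (eLpNorm_indicator_ball_rpow_lt_top hd hq' hq't hαq), (θ.memLp q' volume).2⟩)
      ENNReal.ofReal_lt_top
  have hC₁₂ : C₁ + C₂ < ∞ := ENNReal.add_lt_top.2 ⟨hC₁, hC₂⟩
  have hVt : volume (Metric.ball (0 : EuclideanSpace ℝ (Fin d)) 1) ^ (1 / q.toReal) < ∞ :=
    ENNReal.rpow_lt_top_of_nonneg (by positivity) measure_ball_lt_top.ne
  refine lt_of_le_of_lt (b := (C₁ + C₂) * volume (Metric.ball (0 : EuclideanSpace ℝ (Fin d)) 1) ^
    (1 / q.toReal) + ENNReal.ofReal x) ?_ (ENNReal.add_lt_top.2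
      ⟨ENNReal.mul_lt_top hC₁₂ hVt, ENNReal.ofReal_lt_top⟩)
  refine iSup_le fun f => iSup_le fun g => iSup_le fun h => iSup_le fun hfx => iSup_le fun hg1 => ?_
  have hf := h.locallyIntegrable_left.aestronglyMeasurable
  have hbd := h.ae_enorm_le (C₁ := C₁) (C₂ := C₂) η
    (by
      simp only [hη]
      refine (lintegral_one_sub_bump_mul_le (β := β) hpp h.aestronglyMeasurable_right).trans ?_
      exact mul_le_of_le_one_right (by positivity) hg1)
    (fun z => (lintegral_mul_translate_le hd hq' hqq hf θ hα hC' z).trans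
      (mul_le_mul' le_rfl hfx))
  refine (eLpNorm_le_of_ae_enorm_le hf hα.le hq hC₁₂.ne hbd).trans ?_
  gcongr

end Boundedness

end HeisenbergLp

end

theorem mainTheorem7 (d : ℕ) (hd : 0 < d) (p : ℝ≥0∞) (hp : 1 ≤ p) :
    ∃ β₀ q₀ α₀ : ℝ, 0 < α₀ ∧
      ∀ (q : ℝ≥0∞) (α β : ℝ), 1 ≤ q → ENNReal.ofReal q₀ < q → 0 < β → β₀ < β →
        0 < α → α < α₀ →
        ∀ x : ℝ, 0 < x →
          HeisenbergLp.fourierH d p q α β x < ∞ ∧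
          HeisenbergLp.hadamardSup d p q α β x = ∞ ∧
          HeisenbergLp.hadamardSup' d p q α β x = ∞ := by
  refine ⟨d, 8 * d, 1 / 8, by norm_num, fun q α β hq hqd _ hβ hα hα' x hx => ⟨?_, ?_, ?_⟩⟩
  · exact HeisenbergLp.fourierH_lt_top hd hp hq hα hα' hβ hqd
  · exact HeisenbergLp.hadamardSup_eq_top hd hp hq hα hα' hβ hx hqd
  · exact HeisenbergLp.hadamardSup'_eq_top hd hp hq hα hα' hβ hx hqd
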